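/- **Setting.** Fix $\varepsilon\in\mathbb C\setminus\{0\}$ and put $q=e^{\varepsilon}$, $q^{k/2}=e^{k\varepsilon/2}$ for $k\in\mathbb Z$. The variable $x$ runs over a set $X\subset\mathbb C\setminus\{0\}$ stable under $x\mapsto q^{\pm1/2}x$. All functions $f(x,t)$ are, for each $x\in X$, formal power series over $\mathbb C$ in the times $t=(t_0,t_1,t_2,\dots)$, and $e^{\pm\frac{\varepsilon}{2}x\partial_x}f(x,t)=f(q^{\pm1/2}x,t)$. Let $\Lambda_q=e^{\varepsilon x\partial_x}$. Formal operators $\sum_jX_j(x,t)\Lambda_q^j$ are multiplied by $(X(x)\Lambda_q^i)\circ(Y(x)\Lambda_q^j)=X(x)Y(q^ix)\Lambda_q^{i+j}$, and $A_+$, $A_-$ denote the parts of $A$ with $j\ge0$, $j<0$. *Dressing operators.* Operators $S=1+\omega_1\Lambda_q^{-1}+\omega_2\Lambda_q^{-2}+\cdots$ and $\bar S=\bar\omega_0+\bar\omega_1\Lambda_q+\cdots$ ($\bar S$ invertible among operators of this form) are dressing operators of the $q$-Toda hierarchy (QTH) if $$\mathcal L:=S\Lambda_qS^{-1}=\bar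 S\Lambda_q^{-1}\bar S^{-1}$$ and, with $B_j=\mathcal L^{j+1}/(j+1)!$, the Sato equations $\varepsilon\partial_{t_j}S=-(B_j)_-S$ and $\varepsilon\partial_{t_j}\bar S=(B_j)_+\bar S$ hold for all $j\ge0$. *Tau functions.* Write $t\pm[z]$ for the sequence $(t_j\pm\varepsilon\,j!\,z^{j+1})_{j\ge0}$. The left symbol of $\sum_ja_j(x)\Lambda_q^j$ is $\sum_ja_j(x)\lambda^j$ and the right symbol of $\sum_j\Lambda_q^ja_j'(x)$ is $\sum_ja_j'(x)\lambda^j$. An invertible $\tau=\tau(x,t)$ is a tau function of the QTH if there are dressing operators $S,\bar S$ of the QTH such that $S$ and $\bar S$ have the left symbols $$\frac{\tau(q^{-1/2}x,\,t-[\lambda^{-1}])}{\tau(q^{-1/2}x,\,t)},\qquad \frac{\tau(q^{1/2}x,\,t+[\lambda])}{\tau(q^{-1/2}x,\,t)},$$ and $S^{-1}$ and $\bar S^{-1}$ have the right symbols $$\frac{\tau(q^{1/2}x,\,t+[\lambda^{-1}])}{\tau(q^{1/2}x,\,t)},\qquad \frac{\tau(q^{-1/2}x,\,t-[\lambda])}{\tau(q^{1/2}x,\,t)}.$$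 *Vertex operators.* With $[\lambda]_\partial=\varepsilon\sum_{j\ge0}j!\,\lambda^{j+1}\partial_{t_j}$, let $$\Gamma^{\pm a}=\lambda^{\pm\frac{\log x}{\varepsilon}}\exp\Big(\pm\frac1{2\varepsilon}\sum_{j\ge0}t_j\frac{\lambda^{j+1}}{(j+1)!}\Big)\exp\Big(\mp\frac{\varepsilon}{2}x\partial_x\mp[\lambda^{-1}]_\partial\Big),$$ $$\Gamma^{\pm b}=\lambda^{\mp\frac{\log x}{\varepsilon}}\exp\Big(\pm\frac1{2\varepsilon}\sum_{j\ge0}t_j\frac{\lambda^{-j-1}}{(j+1)!}\Big)\exp\Big(\mp\frac{\varepsilon}{2}x\partial_x\mp[\lambda]_\partial\Big).$$ In $\Gamma^{\pm a}\otimes\Gamma^{\mp a}$ and $\Gamma^{\mp b}\otimes\Gamma^{\pm b}$ the first factor acts in the variables $(x,t)$ and the second in independent variables $(x',t')$. At $x=q^lx'$ the factor $\lambda^{\log x/\varepsilon}\otimes\lambda^{-\log x'/\varepsilon}$ is, by convention, $\lambda^l$. The coefficients of the monomials in $t,t'$ are then Laurent series in $\lambda^{-1}$ (for $a$) or in $\lambda$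 (for $b$), and $\operatorname{Res}_\lambda\sum_n\alpha_n\lambda^n=\alpha_{-1}$. **Theorem.** An invertible function $\tau(x,t)$ is a tau function of the $q$-Toda hierarchy if and only if, for every $l\in\mathbb Z$ and every $r\in\mathbb N=\{0,1,2,\dots\}$, $$\operatorname{Res}_\lambda\lambda^{r-1}\big(\Gamma^{a}\otimes\Gamma^{-a}\big)(\tau\otimes\tau)=\operatorname{Res}_\lambda\lambda^{-r-1}\big(\Gamma^{-b}\otimes\Gamma^{b}\big)(\tau\otimes\tau)\qquad\text{at }x=q^lx',$$ for all $x'\in X$, as an identity of formal power series in $t$ and $t'$. -/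

import Mathlib

open scoped Nat

noncomputable section

namespace QToda

/-! ### The space variable `x` and the dilations `x ↦ q ^ (k / 2) x`, `q = e ^ ε` -/

/-- A set of nonzero complex numbers that is stable under `x ↦ e ^ (± ε / 2) x`: the domain of the
space variable. Typical examples are `ℂ \ {0}` and, for real `ε`, the half line `(0, ∞)`. -/
structure Domain (ε : ℂ) where
  /-- the underlying set of values of `x` -/
  carrier : Set ℂ
  ne_zero : ∀ x ∈ carrier, x ≠ 0
  up : ∀ x ∈ carrier, Complex.exp (ε / 2) * x ∈ carrier
  down : ∀ x ∈ carrier, Complex.exp (-(ε / 2)) * x ∈ carrier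

theorem Domain.exp_mul_mem {ε : ℂ} (X : Domain ε) (k : ℤ) {x : ℂ} (hx : x ∈ X.carrier) :
    Complex.exp ((k : ℂ) * (ε / 2)) * x ∈ X.carrier := by
  induction k using Int.induction_on with
  | zero => simpa using hx
  | succ i ih =>
    have h := X.up _ ih
    rw [← mul_assoc, ← Complex.exp_add] at h
    convert h using 3
    push_cast
    ring
  | pred i ih =>
    have h := X.down _ ih
    rw [← mul_assoc, ← Complex.exp_add] at h
    convert h using 3
    push_cast
    ring

/-- `dil X k x = q ^ (k / 2) x = e ^ (k ε / 2) x`. Composition with it is the operator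
`exp ((k ε / 2) x ∂ₓ)`; in particular `Λ_q ^ i` is `g ↦ g ∘ dil X (2 * i)`. -/
def dil {ε : ℂ} (X : Domain ε) (k : ℤ) (x : X.carrier) : X.carrier :=
  ⟨Complex.exp ((k : ℂ) * (ε / 2)) * (x : ℂ), X.exp_mul_mem k x.2⟩

/-- Formal power series in the times `t₀, t₁, t₂, …`. -/
abbrev TimeSeries : Type := MvPowerSeries ℕ ℂ

/-- Functions of `x` with values in formal power series in the times. -/
abbrev Fn {ε : ℂ} (X : Domain ε) : Type := X.carrier → TimeSeries

/-! ### Formal difference operators `∑ⱼ Xⱼ(x) Λ_q ^ j` -/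

/-- `∑ⱼ Xⱼ(x) Λ_q ^ j`, as the family of its coefficients `j ↦ Xⱼ`. -/
abbrev Op {ε : ℂ} (X : Domain ε) : Type := ℤ → Fn X

/-- The product determined by
`(X(x) Λ_q ^ i) ∘ (Y(x) Λ_q ^ j) = X(x) Y(q ^ i x) Λ_q ^ (i + j)`. The sum is finite when both
factors are bounded above, or both bounded below, in powers of `Λ_q`; the product is only used
for such factors. -/
def comp {ε : ℂ} {X : Domain ε} (A B : Op X) : Op X :=
  fun n x => ∑ᶠ i : ℤ, A i x * B (n - i) (dil X (2 * i) x)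

/-- The operator `Λ_q ^ k`. -/
def shiftPow {ε : ℂ} (X : Domain ε) (k : ℤ) : Op X :=
  fun n _ => if n = k then 1 else 0

/-- The powers `A ^ n` of an operator. -/
def opPow {ε : ℂ} {X : Domain ε} (A : Op X) : ℕ → Op X
  | 0 => shiftPow X 0
  | n + 1 => comp (opPow A n) A

/-- The part `(A)₊` with nonnegative powers of `Λ_q`. -/
def plusPart {ε : ℂ} {X : Domain ε} (A : Op X) : Op X :=
  fun n x => if 0 ≤ n then A n x else 0

/-- The part `(A)₋` with negative powers of `Λ_q`. -/
def minusPart {ε : ℂ} {X : Domain ε} (A : Op X) : Op X :=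
  fun n x => if n < 0 then A n x else 0

/-- `A` has the form `1 + ω₁(x) Λ_q⁻¹ + ω₂(x) Λ_q⁻² + ⋯`. -/
def IsLower {ε : ℂ} {X : Domain ε} (A : Op X) : Prop :=
  A 0 = 1 ∧ ∀ n : ℤ, 0 < n → A n = 0

/-- `A` has the form `ω₀(x) + ω₁(x) Λ_q + ω₂(x) Λ_q² + ⋯`. -/
def IsUpper {ε : ℂ} {X : Domain ε} (A : Op X) : Prop :=
  ∀ n : ℤ, n < 0 → A n = 0

/-- `A` and `B` are inverse to each other. -/
def AreInverse {ε : ℂ} {X : Domain ε} (A B : Op X) : Prop :=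
  comp A B = shiftPow X 0 ∧ comp B A = shiftPow X 0

/-- The Lax operator `L = S Λ_q S⁻¹`. -/
def lax {ε : ℂ} {X : Domain ε} (S Sinv : Op X) : Op X :=
  comp (comp S (shiftPow X 1)) Sinv

/-- `Bⱼ = L ^ (j + 1) / (j + 1)!`. -/
def flowOp {ε : ℂ} {X : Domain ε} (L : Op X) (j : ℕ) : Op X :=
  fun n x => (((j + 1)! : ℕ) : ℂ)⁻¹ • opPow L (j + 1) n x

/-- `∂A / ∂tⱼ`. -/
def timeDeriv {ε : ℂ} {X : Domain ε} (j : ℕ) (A : Op X) : Op X :=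
  fun n x => MvPowerSeries.pderiv ℂ j (A n x)

/-- `S`, `Sb` (with inverses `Sinv`, `Sbinv`) are dressing (wave) operators of the `q`-Toda
hierarchy: `S = 1 + ω₁ Λ_q⁻¹ + ⋯`, `Sb = ω̄₀ + ω̄₁ Λ_q + ⋯` is invertible,
`L = S Λ_q S⁻¹ = Sb Λ_q⁻¹ Sb⁻¹`, and the Sato equations `ε ∂S/∂tⱼ = -(Bⱼ)₋ S`,
`ε ∂Sb/∂tⱼ = (Bⱼ)₊ Sb` hold for all `j`. -/
structure IsDressingPair {ε : ℂ} {X : Domain ε} (S Sinv Sb Sbinv : Op X) : Prop where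
  lower : IsLower S
  lower_inv : IsLower Sinv
  inverse : AreInverse S Sinv
  upper : IsUpper Sb
  upper_inv : IsUpper Sbinv
  inverse_bar : AreInverse Sb Sbinv
  lax_eq : lax S Sinv = comp (comp Sb (shiftPow X (-1))) Sbinv
  sato : ∀ j : ℕ, ε • timeDeriv j S = -comp (minusPart (flowOp (lax S Sinv) j)) S
  sato_bar : ∀ j : ℕ, ε • timeDeriv j Sb = comp (plusPart (flowOp (lax S Sinv) j)) Sb

/-- The coefficients `aⱼ'` in `A = ∑ⱼ Λ_q ^ j aⱼ'(x)`, that is `aⱼ'(x) = Aⱼ(q ^ (-j) x)`; they are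
the coefficients of the right symbol `∑ⱼ aⱼ'(x) λ ^ j`. -/
def rightCoeff {ε : ℂ} {X : Domain ε} (A : Op X) (j : ℤ) : Fn X :=
  fun x => A j (dil X (-2 * j) x)

/-! ### Shifts of the times, and tau functions -/

/-- `exp D = ∑ₙ D ^ n / n!` for a power series `D` without constant term over a (possibly
noncommutative) `ℂ`-algebra; the terms with `n > m` do not contribute to the `m`-th coefficient. -/
def formalExp {E : Type} [Ring E] [Algebra ℂ E] (D : PowerSeries E) : PowerSeries E :=
  PowerSeries.mk fun m =>
    ∑ n ∈ Finset.range (m + 1), ((n ! : ℕ) : ℂ)⁻¹ • PowerSeries.coeff m (D ^ n)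

/-- `c ∑ⱼ j! z ^ (j + 1) ∂/∂tⱼ`, as a power series in `z` whose coefficients are operators on
series in the times. For `c = ε` it is `[z]_∂`. -/
def bracketDeriv (c : ℂ) : PowerSeries (Module.End ℂ TimeSeries) :=
  PowerSeries.mk fun m =>
    match m with
    | 0 => 0
    | j + 1 => (c * ((j ! : ℕ) : ℂ)) • (MvPowerSeries.pderiv ℂ j).toLinearMap

/-- `exp (c ∑ⱼ j! z ^ (j + 1) ∂/∂tⱼ) f`, the Taylor expansion of `f (tⱼ + c j! z ^ (j + 1))`, as a
power series in `z`. -/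
def timeShift (c : ℂ) (f : TimeSeries) : PowerSeries TimeSeries :=
  PowerSeries.mk fun m => (PowerSeries.coeff m (formalExp (bracketDeriv c))) f

/-- `τ` is a tau function of the `q`-Toda hierarchy: the following are the symbols of a pair of
dressing operators `S`, `Sb` (left symbols) and of their inverses (right symbols):
* `S`:    `τ (q ^ (-1/2) x, t - [λ⁻¹]) / τ (q ^ (-1/2) x, t)`,
* `S⁻¹`:  `τ (q ^ (1/2) x, t + [λ⁻¹]) / τ (q ^ (1/2) x, t)`,
* `Sb`:   `τ (q ^ (1/2) x, t + [λ]) / τ (q ^ (-1/2) x, t)`,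
* `Sb⁻¹`: `τ (q ^ (-1/2) x, t - [λ]) / τ (q ^ (1/2) x, t)`,

where `t ± [z]` has the entries `tⱼ ± ε j! z ^ (j + 1)`. The denominators are cleared. -/
def IsTauFunction {ε : ℂ} (X : Domain ε) (τ : Fn X) : Prop :=
  ∃ S Sinv Sb Sbinv : Op X, IsDressingPair S Sinv Sb Sbinv ∧
    ∀ (m : ℕ) (x : X.carrier),
      τ (dil X (-1) x) * S (-(m : ℤ)) x =
          PowerSeries.coeff m (timeShift (-ε) (τ (dil X (-1) x))) ∧
      τ (dil X 1 x) * rightCoeff Sinv (-(m : ℤ)) x =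
          PowerSeries.coeff m (timeShift ε (τ (dil X 1 x))) ∧
      τ (dil X (-1) x) * Sb (m : ℤ) x =
          PowerSeries.coeff m (timeShift ε (τ (dil X 1 x))) ∧
      τ (dil X 1 x) * rightCoeff Sbinv (m : ℤ) x =
          PowerSeries.coeff m (timeShift (-ε) (τ (dil X (-1) x)))

/-! ### Vertex operators

Formal Laurent series in `λ⁻¹` (used for `Γ ^ (± a)`) and in `λ` (used for `Γ ^ (± b)`) are both
modelled by `LaurentSeries ℂ`, whose variable `z` stands for `λ⁻¹` and for `λ` respectively. The
coefficient of every monomial in the times is such a Laurent series. -/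

/-- `λ ^ k` as a Laurent series in `z = λ⁻¹`. -/
def lamA (k : ℤ) : LaurentSeries ℂ := HahnSeries.single (-k) 1

/-- `λ ^ k` as a Laurent series in `z = λ`. -/
def lamB (k : ℤ) : LaurentSeries ℂ := HahnSeries.single k 1

/-- `exp (∑ⱼ cⱼ tⱼ) = ∏ⱼ exp (cⱼ tⱼ)`: the coefficient of `∏ⱼ tⱼ ^ αⱼ` is `∏ⱼ cⱼ ^ αⱼ / αⱼ!`. -/
def linExp (c : ℕ → LaurentSeries ℂ) : MvPowerSeries ℕ (LaurentSeries ℂ) :=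
  fun α => α.prod fun j n => ((n ! : ℕ) : ℂ)⁻¹ • c j ^ n

/-- A power series in `z` over series in the times, regarded as a series in the times whose
coefficients are (Laurent) series in `z`. -/
def swapVars (F : PowerSeries TimeSeries) : MvPowerSeries ℕ (LaurentSeries ℂ) :=
  fun α => HahnSeries.ofPowerSeries ℤ ℂ
    (PowerSeries.mk fun m => MvPowerSeries.coeff α (PowerSeries.coeff m F))

/-- For `σ = ± 1`, the value at `x` of `Γ ^ (σ a) τ` without its factor `λ ^ (σ log x / ε)`:
`exp (σ / (2 ε) ∑ⱼ tⱼ λ ^ (j + 1) / (j + 1)!) exp (-σ (ε / 2) x ∂ₓ - σ [λ⁻¹]_∂) τ`,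
expanded in `z = λ⁻¹`. -/
def gammaA {ε : ℂ} (X : Domain ε) (σ : ℤ) (τ : Fn X) (x : X.carrier) :
    MvPowerSeries ℕ (LaurentSeries ℂ) :=
  linExp (fun j => ((σ : ℂ) / (2 * ε * (((j + 1)! : ℕ) : ℂ))) • lamA ((j : ℤ) + 1)) *
    swapVars (timeShift (-(σ : ℂ) * ε) (τ (dil X (-σ) x)))

/-- For `σ = ± 1`, the value at `x` of `Γ ^ (σ b) τ` without its factor `λ ^ (-σ log x / ε)`:
`exp (σ / (2 ε) ∑ⱼ tⱼ λ ^ (-j - 1) / (j + 1)!) exp (-σ (ε / 2) x ∂ₓ - σ [λ]_∂) τ`,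
expanded in `z = λ`. -/
def gammaB {ε : ℂ} (X : Domain ε) (σ : ℤ) (τ : Fn X) (x : X.carrier) :
    MvPowerSeries ℕ (LaurentSeries ℂ) :=
  linExp (fun j => ((σ : ℂ) / (2 * ε * (((j + 1)! : ℕ) : ℂ))) • lamB (-((j : ℤ) + 1))) *
    swapVars (timeShift (-(σ : ℂ) * ε) (τ (dil X (-σ) x)))

/-- `f(t) g(t')`, a series in the times `t` (indexed by `Sum.inl`) and `t'` (by `Sum.inr`). -/
def tensor (f g : MvPowerSeries ℕ (LaurentSeries ℂ)) :
    MvPowerSeries (ℕ ⊕ ℕ) (LaurentSeries ℂ) :=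
  fun γ => MvPowerSeries.coeff (γ.comapDomain Sum.inl Sum.inl_injective.injOn) f *
    MvPowerSeries.coeff (γ.comapDomain Sum.inr Sum.inr_injective.injOn) g

/-- `(Γ ^ a ⊗ Γ ^ (-a)) (τ ⊗ τ)` at `x = q ^ l x'`, where the factor
`λ ^ (log x / ε) ⊗ λ ^ (- log x' / ε)` is `λ ^ l`. -/
def pairA {ε : ℂ} (X : Domain ε) (τ : Fn X) (l : ℤ) (x' : X.carrier) :
    MvPowerSeries (ℕ ⊕ ℕ) (LaurentSeries ℂ) :=
  MvPowerSeries.C (lamA l) * tensor (gammaA X 1 τ (dil X (2 * l) x')) (gammaA X (-1) τ x')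

/-- `(Γ ^ (-b) ⊗ Γ ^ b) (τ ⊗ τ)` at `x = q ^ l x'`, where the factor
`λ ^ (log x / ε) ⊗ λ ^ (- log x' / ε)` is `λ ^ l`. -/
def pairB {ε : ℂ} (X : Domain ε) (τ : Fn X) (l : ℤ) (x' : X.carrier) :
    MvPowerSeries (ℕ ⊕ ℕ) (LaurentSeries ℂ) :=
  MvPowerSeries.C (lamB l) * tensor (gammaB X (-1) τ (dil X (2 * l) x')) (gammaB X 1 τ x')

/-- `Res_λ`, the coefficient of `λ⁻¹`, for series in `z = λ⁻¹`. -/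
def resA (F : MvPowerSeries (ℕ ⊕ ℕ) (LaurentSeries ℂ)) : MvPowerSeries (ℕ ⊕ ℕ) ℂ :=
  fun γ => (MvPowerSeries.coeff γ F).coeff 1

/-- `Res_λ`, the coefficient of `λ⁻¹`, for series in `z = λ`. -/
def resB (F : MvPowerSeries (ℕ ⊕ ℕ) (LaurentSeries ℂ)) : MvPowerSeries (ℕ ⊕ ℕ) ℂ :=
  fun γ => (MvPowerSeries.coeff γ F).coeff (-1)

end QToda

end

noncomputable section

namespace QToda

/-! ### Bilinear expressions in two independent sequences of times -/

section Polarization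

open MvPowerSeries

variable {R : Type*} [CommRing R]

/-! The residue identities are equivalent to identities between difference operators. A bilinear
expression in independent times t, t' is determined by all its t-derivatives on the diagonal t = t'.
There the exponentials of the two vertex operators are inverse to each other, and their only trace
is that ∂ⱼ becomes ∂ⱼ plus σ/(2ε(j+1)!) times a shift by Λ_q^(σ(j+1)), a twisted derivation D_j.
What remains is a product of a left and a right symbol, whose coefficients are those of a
composition. With σ = 1 for a and σ = -1 for b, and with operators W_σ, V_σ read off from τ, the
identities become (D^a W_1) Λ_q^r V_1 = (D^a W_{-1}) Λ_q^(-r) V_{-1} for all r and all iterated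
derivatives D^a (`forall_residue_eq_iff`).

If τ is a tau function, then W_1 = g S, V_1 = S⁻¹ k, W_{-1} = g S̄, V_{-1} = S̄⁻¹ k, with g, k
multiplications by τ(q^(-1/2)x), τ(q^(1/2)x). The Sato equations say that D_j multiplies both S and
S̄ on the left by the same operator ((B_j)₊ - (B_j)₋)/(2ε). Hence both sides equal P_a L^r k with a
common P_a (`iterate_dressedDeriv_comp_comp`).

Conversely, divide W_σ, V_σ by g, k. The case r = 0 without derivatives equates an operator with
powers ≤ 0 to one with powers ≥ 0, so both are 1 and the V's are inverses; r = 1 is the Lax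
equation; one derivative at r = 0 gives ε S_t S⁻¹ + B_j = ε S̄_t S̄⁻¹, which splits by the sign of
the power into the Sato equations (`isDressingPair_of_comp_eq`). Higher derivatives are not needed.
-/

theorem coeff_pderiv_eq_nsmul (j : ℕ) (f : MvPowerSeries ℕ R) (α : ℕ →₀ ℕ) :
    coeff α (pderiv R j f) = (α j + 1) • coeff (α + Finsupp.single j 1) f := by
  rw [coeff_pderiv, nsmul_eq_mul, mul_comm]
  push_cast
  rfl

/-- Up to a nonzero integer, every coefficient is the constant term of an iterated derivative. -/
theorem exists_constantCoeff_iterate_pderiv (α : ℕ →₀ ℕ) :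
    ∃ (a : List ℕ) (c : ℕ), c ≠ 0 ∧ ∀ f : MvPowerSeries ℕ R,
      constantCoeff (a.foldr (fun j => pderiv R j) f) = c • coeff α f := by
  obtain ⟨d, hd⟩ : ∃ d, α.degree = d := ⟨_, rfl⟩
  induction d generalizing α with
  | zero =>
    refine ⟨[], 1, one_ne_zero, fun f => ?_⟩
    rw [(Finsupp.degree_eq_zero_iff α).1 hd]
    simp
  | succ d ih =>
    have hα : α ≠ 0 := by
      rintro rfl
      simp at hd
    obtain ⟨j, hj⟩ := Finsupp.ne_iff.1 hα
    have hle : Finsupp.single j 1 ≤ α := by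
      rw [Finsupp.single_le_iff]
      exact Nat.one_le_iff_ne_zero.2 hj
    obtain ⟨β, rfl⟩ := exists_add_of_le hle
    obtain ⟨a, c, hc, h⟩ := ih β (by
      simp only [map_add, Finsupp.degree_single] at hd
      omega)
    refine ⟨a ++ [j], c * (β j + 1), by positivity, fun f => ?_⟩
    rw [List.foldr_append, List.foldr_cons, List.foldr_nil, h, coeff_pderiv_eq_nsmul, mul_smul,
      add_comm β]

/-- Two bilinear expressions `ρ (f(t) g(t'))` and `ψ (f'(t) g'(t'))` agree if and only if all
derivatives with respect to `t` agree on the diagonal `t = t'`. -/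
theorem bilinear_agree_iff (ρ ψ : R →+ ℂ) (f g f' g' : MvPowerSeries ℕ R) :
    (∀ α β, ρ (coeff α f * coeff β g) = ψ (coeff α f' * coeff β g')) ↔
      ∀ (a : List ℕ) (γ : ℕ →₀ ℕ),
        ρ (coeff γ (a.foldr (fun j => pderiv R j) f * g)) =
          ψ (coeff γ (a.foldr (fun j => pderiv R j) f' * g')) := by
  constructor
  · intro h a
    have key : ∀ α β, ρ (coeff α (a.foldr (fun j => pderiv R j) f) * coeff β g) =
        ψ (coeff α (a.foldr (fun j => pderiv R j) f') * coeff β g') := by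
      induction a with
      | nil => exact h
      | cons j a ih =>
        intro α β
        simp only [List.foldr_cons, coeff_pderiv_eq_nsmul, smul_mul_assoc, map_nsmul, ih]
    intro γ
    simp only [coeff_mul, map_sum, key]
  · intro h
    have key : ∀ (b a : List ℕ) (γ : ℕ →₀ ℕ),
        ρ (coeff γ (a.foldr (fun j => pderiv R j) f * b.foldr (fun j => pderiv R j) g)) =
          ψ (coeff γ (a.foldr (fun j => pderiv R j) f' * b.foldr (fun j => pderiv R j) g')) := by
      intro b
      induction b with
      | nil => exact h
      | cons j b ih =>
        intro a γ
        -- A derivative of the second factor is traded for a derivative of the whole product minus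
        -- one of the first factor; both are known to agree on the diagonal.
        have leib : ∀ u v : MvPowerSeries ℕ R,
            u * pderiv R j v = pderiv R j (u * v) - pderiv R j u * v := by
          intro u v
          rw [Derivation.leibniz, smul_eq_mul, smul_eq_mul]
          ring
        have h1 := ih (j :: a) γ
        rw [List.foldr_cons, List.foldr_cons] at h1
        simp only [List.foldr_cons, leib, map_sub, coeff_pderiv_eq_nsmul, map_nsmul, ih, h1]
    intro α β
    obtain ⟨a, c, hc, ha⟩ := exists_constantCoeff_iterate_pderiv (R := R) α
    obtain ⟨b, d, hd, hb⟩ := exists_constantCoeff_iterate_pderiv (R := R) β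
    -- The constant term of a product is the product of the constant terms, so the diagonal at t = 0
    -- separates the coefficients of the two factors.
    have h0 := key b a 0
    simp only [coeff_zero_eq_constantCoeff_apply, map_mul, ha, hb, smul_mul_smul_comm,
      map_nsmul] at h0
    exact smul_right_injective ℂ (mul_ne_zero hc hd) h0

/-- The derivation `∂ / ∂tⱼ` conjugated by an exponential factor: `F ↦ ∂F / ∂tⱼ + cⱼ F`. -/
def twistedDeriv (c : ℕ → R) (j : ℕ) (F : MvPowerSeries ℕ R) : MvPowerSeries ℕ R :=
  pderiv R j F + C (c j) * F

end Polarization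

/-! ### Exponentials linear in the times, and conjugation by them -/

section LinExp

open MvPowerSeries

theorem linExp_add_single (c : ℕ → LaurentSeries ℂ) (j : ℕ) (α : ℕ →₀ ℕ) :
    (α j + 1) • linExp c (α + Finsupp.single j 1) = c j * linExp c α := by
  classical
  unfold linExp
  have h0 : ∀ i, (((0 : ℕ)! : ℕ) : ℂ)⁻¹ • c i ^ 0 = 1 := by simp
  -- Both products are taken over one index set containing j, where zero exponents contribute 1, so
  -- that only the factor at j differs.
  rw [Finsupp.prod_of_support_subset (s := insert j α.support) (α + Finsupp.single j 1)
    (by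
      intro i hi
      simp only [Finsupp.mem_support_iff, Finsupp.add_apply, Finset.mem_insert] at hi ⊢
      by_cases hij : i = j
      · exact Or.inl hij
      · right
        simpa [Finsupp.single_apply, Ne.symm hij] using hi) _ (fun i _ => h0 i),
    Finsupp.prod_of_support_subset (s := insert j α.support) α (by simp) _ (fun i _ => h0 i),
    ← Finset.mul_prod_erase _ _ (Finset.mem_insert_self j _),
    ← Finset.mul_prod_erase _ _ (Finset.mem_insert_self j _)]
  have hrest : ∀ i ∈ (insert j α.support).erase j,
      ((((α + Finsupp.single j 1 : ℕ →₀ ℕ) i)! : ℕ) : ℂ)⁻¹ • c i ^ ((α + Finsupp.single j 1 : ℕ →₀ ℕ) i) =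
        (((α i)! : ℕ) : ℂ)⁻¹ • c i ^ (α i) := by
    intro i hi
    have : (α + Finsupp.single j 1 : ℕ →₀ ℕ) i = α i := by
      simp [Ne.symm (Finset.ne_of_mem_erase hi)]
    rw [this]
  rw [Finset.prod_congr rfl hrest, ← smul_mul_assoc, ← mul_assoc]
  congr 1
  have : (α + Finsupp.single j 1 : ℕ →₀ ℕ) j = α j + 1 := by simp
  rw [this, ← Nat.cast_smul_eq_nsmul ℂ, smul_smul, ← HahnSeries.C_mul_eq_smul,
    ← HahnSeries.C_mul_eq_smul, mul_left_comm, ← pow_succ', Nat.factorial_succ]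
  congr 2
  push_cast
  have h1 : ((α j : ℂ) + 1) ≠ 0 := by exact_mod_cast Nat.succ_ne_zero (α j)
  have h2 : (((α j)! : ℕ) : ℂ) ≠ 0 := by exact_mod_cast Nat.factorial_ne_zero (α j)
  field_simp

theorem pderiv_linExp (c : ℕ → LaurentSeries ℂ) (j : ℕ) :
    pderiv (LaurentSeries ℂ) j (linExp c) = C (c j) * linExp c := by
  ext1 α
  rw [coeff_pderiv_eq_nsmul, coeff_C_mul]
  exact linExp_add_single c j α

/-- All partial derivatives of the product vanish and its constant term is 1; torsion-freeness makes
such a series constant. -/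
theorem linExp_mul_linExp_neg (c : ℕ → LaurentSeries ℂ) :
    linExp c * linExp (fun j => -c j) = 1 := by
  have : IsAddTorsionFree (LaurentSeries ℂ) := IsAddTorsionFree.of_module_rat _
  refine pderiv.ext (fun j => ?_) ?_
  · rw [Derivation.leibniz, pderiv_linExp, pderiv_linExp]
    simp only [smul_eq_mul, map_neg, Derivation.map_one_eq_zero]
    ring
  · rw [map_mul, map_one]
    have h : ∀ c, constantCoeff (linExp c) = 1 := by
      intro c
      rw [← coeff_zero_eq_constantCoeff_apply]
      exact Finsupp.prod_zero_index (h := fun j n => ((n ! : ℕ) : ℂ)⁻¹ • c j ^ n)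
    rw [h, h, one_mul]

theorem iterate_pderiv_linExp_mul (c : ℕ → LaurentSeries ℂ)
    (F : MvPowerSeries ℕ (LaurentSeries ℂ)) (a : List ℕ) :
    a.foldr (fun j => pderiv (LaurentSeries ℂ) j) (linExp c * F) =
      linExp c * a.foldr (twistedDeriv c) F := by
  induction a with
  | nil => rfl
  | cons j a ih =>
    rw [List.foldr_cons, List.foldr_cons, ih, twistedDeriv, Derivation.leibniz, pderiv_linExp]
    simp only [smul_eq_mul]
    ring

end LinExp

/-! ### Difference operators: dilations and powers of `Λ_q` -/

theorem dil_dil {ε : ℂ} (X : Domain ε) (k m : ℤ) (x : X.carrier) :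
    dil X k (dil X m x) = dil X (k + m) x := by
  apply Subtype.ext
  simp only [dil]
  rw [← mul_assoc, ← Complex.exp_add]
  congr 2
  push_cast
  ring

theorem dil_zero {ε : ℂ} (X : Domain ε) (x : X.carrier) : dil X 0 x = x := by
  apply Subtype.ext
  simp [dil]

theorem comp_shiftPow {ε : ℂ} {X : Domain ε} (A : Op X) (k n : ℤ) (x : X.carrier) :
    comp A (shiftPow X k) n x = A (n - k) x := by
  unfold comp shiftPow
  rw [finsum_eq_single _ (n - k)]
  · simp
  · intro i hi
    rw [if_neg (by omega), mul_zero]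

theorem shiftPow_comp {ε : ℂ} {X : Domain ε} (A : Op X) (k n : ℤ) (x : X.carrier) :
    comp (shiftPow X k) A n x = A (n - k) (dil X (2 * k) x) := by
  unfold comp shiftPow
  rw [finsum_eq_single _ k]
  · simp
  · intro i hi
    rw [if_neg hi, zero_mul]

/-! ### Coefficients of Laurent series in `λ ^ (± 1)` with values in series in the times -/

section Symbol

open MvPowerSeries

/-- `F`, a series in the times whose coefficients are Laurent series in `z`, equals
`∑ᵢ aᵢ z ^ i`. -/
def HasExpansion (F : MvPowerSeries ℕ (LaurentSeries ℂ)) (a : ℤ → TimeSeries) : Prop :=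
  ∀ α i, (coeff α F).coeff i = coeff α (a i)

theorem hasExpansion_swapVars (P : PowerSeries TimeSeries) :
    HasExpansion (swapVars P) fun i => (HahnSeries.ofPowerSeries ℤ TimeSeries P).coeff i := by
  intro α i
  change (HahnSeries.ofPowerSeries ℤ ℂ
    (PowerSeries.mk fun m => coeff α (PowerSeries.coeff m P))).coeff i = _
  beta_reduce
  rw [PowerSeries.coeff_coe, PowerSeries.coeff_coe]
  split_ifs <;> simp

theorem HasExpansion.congr {F : MvPowerSeries ℕ (LaurentSeries ℂ)} {a b : ℤ → TimeSeries}
    (h : HasExpansion F a) (hab : ∀ i, a i = b i) : HasExpansion F b :=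
  funext hab ▸ h

theorem HasExpansion.twistedDeriv {F : MvPowerSeries ℕ (LaurentSeries ℂ)} {a : ℤ → TimeSeries}
    (h : HasExpansion F a) (κ : ℕ → ℂ) (d : ℕ → ℤ) (j : ℕ) :
    HasExpansion (twistedDeriv (fun j => κ j • HahnSeries.single (-d j) 1) j F)
      fun i => pderiv ℂ j (a i) + κ j • a (i + d j) := by
  intro α i
  rw [QToda.twistedDeriv, map_add, map_add, HahnSeries.coeff_add, coeff_pderiv_eq_nsmul,
    coeff_pderiv_eq_nsmul, coeff_C_mul, ← HahnSeries.C_mul_eq_smul, mul_assoc,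
    HahnSeries.C_mul_eq_smul, HahnSeries.coeff_smul, HahnSeries.coeff_smul,
    HahnSeries.coeff_single_mul, h, h]
  simp

/-- The range of summation depends only on the bounds and not on the supports of the factors, so the
sum can later be interchanged with the sum over monomials in the times. -/
theorem laurentSeries_coeff_mul (x y : LaurentSeries ℂ) (N : ℤ)
    (hx : ∀ i < N, x.coeff i = 0) (hy : ∀ i < 0, y.coeff i = 0) (n : ℤ) :
    (x * y).coeff n = ∑ i ∈ Finset.Icc N n, x.coeff i * y.coeff (n - i) := by
  rw [HahnSeries.coeff_mul]
  refine Finset.sum_of_injOn Prod.fst ?_ ?_ ?_ ?_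
  · rintro ⟨i, k⟩ hi ⟨i', k'⟩ hi' h
    simp only [Finset.mem_coe, Finset.mem_antidiagonal] at hi hi'
    simp only at h
    ext <;> simp <;> omega
  · rintro ⟨i, k⟩ hi
    simp only [Finset.mem_coe, Finset.mem_antidiagonal, HahnSeries.mem_support] at hi
    simp only [Finset.coe_Icc, Set.mem_Icc]
    have h1 := mt (hx i)
    have h2 := mt (hy k)
    have := h1 hi.1
    have := h2 hi.2.1
    omega
  · intro i _ hi
    by_contra hne
    refine hi ⟨(i, n - i), ?_, rfl⟩
    simp only [Finset.mem_coe, Finset.mem_antidiagonal, HahnSeries.mem_support]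
    exact ⟨left_ne_zero_of_mul hne, right_ne_zero_of_mul hne, by ring⟩
  · rintro ⟨i, k⟩ hi
    simp only [Finset.mem_antidiagonal] at hi
    rw [← hi.2.2]
    simp

/-- The lower bound `N` is uniform in the monomials of the times; this makes the sum over i finite.
The exponentials themselves have no such bound, so they must be cancelled first. -/
theorem HasExpansion.coeff_mul {F G : MvPowerSeries ℕ (LaurentSeries ℂ)} {a b : ℤ → TimeSeries}
    (hF : HasExpansion F a) (hG : HasExpansion G b) (N : ℤ) (ha : ∀ i < N, a i = 0)
    (hb : ∀ i < 0, b i = 0) (γ : ℕ →₀ ℕ) (n : ℤ) :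
    (coeff γ (F * G)).coeff n = coeff γ (∑ᶠ i, a i * b (n - i)) := by
  classical
  have hsupp : (Function.support fun i => a i * b (n - i)) ⊆ Finset.Icc N n := by
    intro i hi
    rw [Finset.coe_Icc, Set.mem_Icc]
    have h1 := mt (ha i) (left_ne_zero_of_mul hi)
    have h2 := mt (hb (n - i)) (right_ne_zero_of_mul hi)
    omega
  rw [finsum_eq_sum_of_support_subset _ hsupp, map_sum, MvPowerSeries.coeff_mul,
    HahnSeries.coeff_sum]
  simp only [MvPowerSeries.coeff_mul]
  rw [Finset.sum_comm]
  refine Finset.sum_congr rfl fun p _ => ?_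
  rw [laurentSeries_coeff_mul _ _ N (fun i hi => by rw [hF, ha i hi, map_zero])
    (fun i hi => by rw [hG, hb i hi, map_zero])]
  exact Finset.sum_congr rfl fun i _ => by rw [hF, hG]

end Symbol

/-! ### The bilinear identities in operator form -/

section Operators

variable {ε : ℂ} (X : Domain ε)

/-- The coefficients in `z` of `exp (-σ (ε / 2) x ∂ₓ - σ [z]_∂) τ`. -/
def shiftedTau (σ : ℤ) (τ : Fn X) (x : X.carrier) (i : ℤ) : TimeSeries :=
  (HahnSeries.ofPowerSeries ℤ TimeSeries (timeShift (-(σ : ℂ) * ε) (τ (dil X (-σ) x)))).coeff i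

/-- The operator in powers of `Λ_q ^ (-σ)` with left symbol `shiftedTau X σ τ`. -/
def leftOp (σ : ℤ) (τ : Fn X) : Op X :=
  fun n x => shiftedTau X σ τ x (-σ * n)

/-- The operator in powers of `Λ_q ^ (-σ)` with right symbol `shiftedTau X (-σ) τ`. -/
def rightOp (σ : ℤ) (τ : Fn X) : Op X :=
  fun n x => shiftedTau X (-σ) τ (dil X (2 * n) x) (-σ * n)

/-- The coefficients `σ / (2 ε (j + 1)!)` of the exponents of the vertex operators. -/
def expCoeff (ε : ℂ) (σ : ℤ) (j : ℕ) : ℂ :=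
  (σ : ℂ) / (2 * ε * (((j + 1)! : ℕ) : ℂ))

/-- The derivation `∂ / ∂tⱼ` conjugated by right multiplication with the exponential of
`σ / (2 ε) ∑ⱼ tⱼ Λ_q ^ (σ (j + 1)) / (j + 1)!`. -/
def dressedDeriv {X : Domain ε} (σ : ℤ) (j : ℕ) (A : Op X) : Op X :=
  fun n x => MvPowerSeries.pderiv ℂ j (A n x) + expCoeff ε σ j • A (n - σ * (j + 1)) x

theorem shiftedTau_of_neg (σ : ℤ) (τ : Fn X) (x : X.carrier) {i : ℤ} (hi : i < 0) :
    shiftedTau X σ τ x i = 0 := by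
  unfold shiftedTau
  rw [PowerSeries.coeff_coe, if_pos hi]

/-- In the local variable z, which is λ⁻¹ for a and λ for b, the two vertex operators coincide. They
differ only in the power of λ coming from log x and in the position of the residue. -/
theorem gammaA_eq_gammaB (σ : ℤ) (τ : Fn X) (x : X.carrier) :
    gammaA X σ τ x = gammaB X σ τ x := by
  unfold gammaA gammaB lamA lamB
  rfl

theorem gammaB_eq (σ : ℤ) (τ : Fn X) (x : X.carrier) :
    gammaB X σ τ x = linExp (fun j => expCoeff ε σ j • HahnSeries.single (-((j : ℤ) + 1)) 1) *
      swapVars (timeShift (-(σ : ℂ) * ε) (τ (dil X (-σ) x))) :=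
  rfl

theorem hasExpansion_iterate_twistedDeriv {σ : ℤ} (hσ : σ * σ = 1) (τ : Fn X) (x : X.carrier)
    (a : List ℕ) :
    HasExpansion
      (a.foldr (twistedDeriv fun j => expCoeff ε σ j • HahnSeries.single (-((j : ℤ) + 1)) 1)
        (swapVars (timeShift (-(σ : ℂ) * ε) (τ (dil X (-σ) x)))))
      fun i => a.foldr (dressedDeriv σ) (leftOp X σ τ) (-σ * i) x := by
  induction a with
  | nil =>
    refine (hasExpansion_swapVars _).congr fun i => ?_
    rw [List.foldr_nil, leftOp, shiftedTau]
    congr 1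
    linear_combination -i * hσ
  | cons j a ih =>
    refine (ih.twistedDeriv (expCoeff ε σ) (fun j => (j : ℤ) + 1) j).congr fun i => ?_
    rw [List.foldr_cons, dressedDeriv]
    congr 3
    ring_nf

/-- Each twisted derivation lowers the order in z by at most j + 1, uniformly in x and in the
monomials. -/
theorem iterate_dressedDeriv_leftOp_eq_zero {σ : ℤ} (hσ : σ * σ = 1) (τ : Fn X) (a : List ℕ) :
    ∃ N : ℤ, ∀ i < N, ∀ x, a.foldr (dressedDeriv σ) (leftOp X σ τ) (-σ * i) x = 0 := by
  induction a with
  | nil =>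
    refine ⟨0, fun i hi x => shiftedTau_of_neg X σ τ x ?_⟩
    have : -σ * (-σ * i) = i := by linear_combination i * hσ
    omega
  | cons j a ih =>
    obtain ⟨N, hN⟩ := ih
    refine ⟨N - (j + 1), fun i hi x => ?_⟩
    have h := hN (i + (j + 1)) (by omega) x
    have e : -σ * i - σ * (j + 1) = -σ * (i + (j + 1)) := by ring
    rw [List.foldr_cons, dressedDeriv, e, h, hN i (by omega), map_zero, smul_zero, add_zero]

/-- The dictionary between vertex operators and difference operators: the exponentials cancel on the
diagonal, and the Cauchy product of a left and a right symbol is the convolution that defines the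
composition. -/
theorem coeff_iterate_pderiv_gammaB_mul {σ : ℤ} (hσ : σ * σ = 1) (τ : Fn X) (l r : ℤ)
    (x x' : X.carrier) (hx : x = dil X (2 * l) x') (a : List ℕ) (γ : ℕ →₀ ℕ) :
    (MvPowerSeries.coeff γ
        (a.foldr (fun j => MvPowerSeries.pderiv (LaurentSeries ℂ) j) (gammaB X σ τ x) *
          gammaB X (-σ) τ x')).coeff (r + σ * l) =
      MvPowerSeries.coeff γ (comp (comp (a.foldr (dressedDeriv σ) (leftOp X σ τ))
        (shiftPow X (σ * r))) (rightOp X σ τ) (-l) x) := by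
  have hc : (fun j : ℕ => expCoeff ε (-σ) j • (HahnSeries.single (-((j : ℤ) + 1)) 1 :
      LaurentSeries ℂ)) =
      fun j => -(expCoeff ε σ j • HahnSeries.single (-((j : ℤ) + 1)) 1) := by
    funext j
    ext n
    rw [HahnSeries.coeff_neg, HahnSeries.coeff_smul, HahnSeries.coeff_smul, ← neg_smul, expCoeff,
      expCoeff, Int.cast_neg, neg_div]
  obtain ⟨N, hN⟩ := iterate_dressedDeriv_leftOp_eq_zero X hσ τ a
  rw [gammaB_eq, gammaB_eq X (-σ), hc, iterate_pderiv_linExp_mul, mul_mul_mul_comm,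
    linExp_mul_linExp_neg, one_mul,
    (hasExpansion_iterate_twistedDeriv X hσ τ x a).coeff_mul (hasExpansion_swapVars _) N
      (fun i hi => hN i hi x) (fun i hi => shiftedTau_of_neg X (-σ) τ x' hi)]
  congr 1
  -- The term z^k of the left symbol belongs to Λ_q^(-σk), hence to Λ_q^(σ(r-k)) after the shift by
  -- σr. The identities `e2`, `e3` match the power of z in the right symbol and bring its argument
  -- back to x'.
  let e : ℤ ≃ ℤ :=
    { toFun := fun k => σ * (r - k)
      invFun := fun i => r - σ * i
      left_inv := fun k => by linear_combination (k - r) * hσ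
      right_inv := fun i => by linear_combination i * hσ }
  refine Eq.trans (finsum_congr fun k => ?_) (finsum_comp_equiv e)
  have e1 : σ * (r - k) - σ * r = -σ * k := by ring
  have e2 : -σ * (-l - σ * (r - k)) = r + σ * l - k := by
    linear_combination (r - k) * hσ
  have e3 : 2 * (-l - σ * (r - k)) + 2 * (σ * (r - k)) + 2 * l = 0 := by ring
  simp only [e, Equiv.coe_fn_mk]
  rw [comp_shiftPow, e1, rightOp, e2, hx, dil_dil, dil_dil, e3, dil_zero, shiftedTau]

theorem forall_coeff_tensor (P : (ℕ →₀ ℕ) → (ℕ →₀ ℕ) → Prop) :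
    (∀ γ : ℕ ⊕ ℕ →₀ ℕ, P (γ.comapDomain Sum.inl Sum.inl_injective.injOn)
      (γ.comapDomain Sum.inr Sum.inr_injective.injOn)) ↔ ∀ α β, P α β := by
  refine ⟨fun h α β => ?_, fun h γ => h _ _⟩
  have h1 := h (Finsupp.sumElim α β)
  convert h1 using 1 <;> ext i <;> simp

theorem coeff_tensor (γ : ℕ ⊕ ℕ →₀ ℕ) (f g : MvPowerSeries ℕ (LaurentSeries ℂ)) :
    MvPowerSeries.coeff γ (tensor f g) =
      MvPowerSeries.coeff (γ.comapDomain Sum.inl Sum.inl_injective.injOn) f *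
        MvPowerSeries.coeff (γ.comapDomain Sum.inr Sum.inr_injective.injOn) g :=
  rfl

theorem forall_residue_eq_iff (τ : Fn X) :
    (∀ (l : ℤ) (r : ℕ) (x' : X.carrier),
        resA (MvPowerSeries.C (lamA ((r : ℤ) - 1)) * pairA X τ l x') =
          resB (MvPowerSeries.C (lamB (-(r : ℤ) - 1)) * pairB X τ l x')) ↔
      ∀ (r : ℕ) (a : List ℕ),
        comp (comp (a.foldr (dressedDeriv 1) (leftOp X 1 τ)) (shiftPow X (1 * r)))
            (rightOp X 1 τ) =
          comp (comp (a.foldr (dressedDeriv (-1)) (leftOp X (-1) τ)) (shiftPow X (-1 * r)))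
            (rightOp X (-1) τ) := by
  have hres : ∀ (l : ℤ) (r : ℕ) (x' : X.carrier),
      (resA (MvPowerSeries.C (lamA ((r : ℤ) - 1)) * pairA X τ l x') =
          resB (MvPowerSeries.C (lamB (-(r : ℤ) - 1)) * pairB X τ l x')) ↔
        ∀ a : List ℕ,
          comp (comp (a.foldr (dressedDeriv 1) (leftOp X 1 τ)) (shiftPow X (1 * r)))
              (rightOp X 1 τ) (-l) (dil X (2 * l) x') =
            comp (comp (a.foldr (dressedDeriv (-1)) (leftOp X (-1) τ)) (shiftPow X (-1 * r)))
              (rightOp X (-1) τ) (-l) (dil X (2 * l) x') := by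
    intro l r x'
    have h := bilinear_agree_iff
      (HahnSeries.coeff.addMonoidHom (R := ℂ) ((r : ℤ) + 1 * l))
      (HahnSeries.coeff.addMonoidHom (R := ℂ) ((r : ℤ) + -1 * l))
      (gammaB X 1 τ (dil X (2 * l) x')) (gammaB X (-1) τ x')
      (gammaB X (-1) τ (dil X (2 * l) x')) (gammaB X (- -1) τ x')
    simp only [HahnSeries.coeff.addMonoidHom_apply] at h
    rw [forall_congr' fun a => MvPowerSeries.ext_iff]
    simp only [← coeff_iterate_pderiv_gammaB_mul X (σ := 1) rfl τ l r _ x' rfl,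
      ← coeff_iterate_pderiv_gammaB_mul X (σ := -1) rfl τ l r _ x' rfl]
    rw [← h, ← forall_coeff_tensor]
    refine funext_iff.trans (forall_congr' fun γ => ?_)
    unfold resA resB pairA pairB lamA lamB
    rw [MvPowerSeries.coeff_C_mul, MvPowerSeries.coeff_C_mul, MvPowerSeries.coeff_C_mul,
      MvPowerSeries.coeff_C_mul, HahnSeries.coeff_single_mul, HahnSeries.coeff_single_mul,
      HahnSeries.coeff_single_mul, HahnSeries.coeff_single_mul, coeff_tensor, coeff_tensor,
      gammaA_eq_gammaB, gammaA_eq_gammaB, one_mul, one_mul, one_mul, one_mul,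
      -- The prefactors λ^(±r-1) and λ^l move the residue, at z¹ for a and z⁻¹ for b, to z^(r+σl).
      show (1 : ℤ) - -((r : ℤ) - 1) - -l = r + 1 * l by ring,
      show (-1 : ℤ) - (-(r : ℤ) - 1) - l = r + -1 * l by ring, neg_neg]
  constructor
  · intro h r a
    funext n x
    -- Since l and x' are arbitrary, every coefficient at every point occurs: l = -n and x' = q^n x
    -- give that of Λ_q^n at x.
    have h1 := (hres (-n) r (dil X (2 * n) x)).1 (h _ _ _) a
    rwa [dil_dil, neg_neg, mul_neg, neg_add_cancel, dil_zero] at h1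
  · intro h l r x'
    rw [hres]
    intro a
    rw [h]

end Operators

/-! ### The algebra of difference operators that are bounded on one side -/

section Algebra

variable {ε : ℂ} {X : Domain ε}

/-- For `σ = 1`, the powers of `Λ_q` in `A` are bounded above; for `σ = -1`, below. -/
def IsBounded (σ : ℤ) (A : Op X) : Prop :=
  ∃ N : ℤ, ∀ n, N < σ * n → A n = 0

theorem mem_image_Icc {σ : ℤ} (hσ : σ * σ = 1) {a b i : ℤ} (h1 : a ≤ σ * i) (h2 : σ * i ≤ b) :
    i ∈ (Finset.Icc a b).image (σ * ·) :=
  Finset.mem_image.2 ⟨σ * i, Finset.mem_Icc.2 ⟨h1, h2⟩, by linear_combination i * hσ⟩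

theorem comp_support_finite {σ : ℤ} (hσ : σ * σ = 1) {A B : Op X} (hA : IsBounded σ A)
    (hB : IsBounded σ B) (n : ℤ) (x : X.carrier) :
    (Function.support fun i => A i x * B (n - i) (dil X (2 * i) x)).Finite := by
  obtain ⟨N, hN⟩ := hA
  obtain ⟨M, hM⟩ := hB
  refine ((Finset.Icc (σ * n - M) N).image (σ * ·)).finite_toSet.subset fun i hi => ?_
  have h1 : ¬ N < σ * i := fun h => left_ne_zero_of_mul hi (congrFun (hN i h) x)
  have h2 : ¬ M < σ * (n - i) := fun h => right_ne_zero_of_mul hi (congrFun (hM _ h) _)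
  rw [mul_sub] at h2
  exact mem_image_Icc hσ (by omega) (by omega)

theorem IsBounded.comp {σ : ℤ} {A B : Op X} (hA : IsBounded σ A) (hB : IsBounded σ B) :
    IsBounded σ (comp A B) := by
  obtain ⟨N, hN⟩ := hA
  obtain ⟨M, hM⟩ := hB
  refine ⟨N + M, fun n hn => funext fun x => ?_⟩
  refine (finsum_congr fun i => ?_).trans finsum_zero
  by_cases h : N < σ * i
  · rw [hN i h, Pi.zero_apply, zero_mul]
  · rw [hM (n - i) (by rw [mul_sub]; omega), Pi.zero_apply, mul_zero]

theorem IsBounded.add {σ : ℤ} {A B : Op X} (hA : IsBounded σ A) (hB : IsBounded σ B) :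
    IsBounded σ (A + B) := by
  obtain ⟨N, hN⟩ := hA
  obtain ⟨M, hM⟩ := hB
  refine ⟨max N M, fun n hn => ?_⟩
  rw [Pi.add_apply, hN n (by omega), hM n (by omega), add_zero]

theorem IsBounded.smul {σ : ℤ} {A : Op X} (hA : IsBounded σ A) (c : ℂ) : IsBounded σ (c • A) := by
  obtain ⟨N, hN⟩ := hA
  exact ⟨N, fun n hn => by rw [Pi.smul_apply, hN n hn, smul_zero]⟩

theorem IsBounded.sub {σ : ℤ} {A B : Op X} (hA : IsBounded σ A) (hB : IsBounded σ B) :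
    IsBounded σ (A - B) := by
  rw [sub_eq_add_neg, ← neg_one_smul ℂ B]
  exact hA.add (hB.smul _)

theorem IsBounded.timeDeriv {σ : ℤ} {A : Op X} (hA : IsBounded σ A) (j : ℕ) :
    IsBounded σ (timeDeriv j A) := by
  obtain ⟨N, hN⟩ := hA
  refine ⟨N, fun n hn => funext fun x => ?_⟩
  rw [QToda.timeDeriv, hN n hn, Pi.zero_apply, map_zero]

theorem IsBounded.minusPart {σ : ℤ} {A : Op X} (hA : IsBounded σ A) :
    IsBounded σ (minusPart A) := by
  obtain ⟨N, hN⟩ := hA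
  refine ⟨N, fun n hn => funext fun x => ?_⟩
  rw [QToda.minusPart, hN n hn, Pi.zero_apply, ite_self]

theorem isBounded_shiftPow (σ k : ℤ) : IsBounded σ (shiftPow X k) := by
  refine ⟨σ * k, fun n hn => funext fun x => ?_⟩
  rw [shiftPow, if_neg (by rintro rfl; exact lt_irrefl _ hn), Pi.zero_apply]

theorem IsBounded.opPow {σ : ℤ} {A : Op X} (hA : IsBounded σ A) (n : ℕ) :
    IsBounded σ (opPow A n) := by
  induction n with
  | zero => exact isBounded_shiftPow σ 0
  | succ n ih => exact ih.comp hA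

theorem IsBounded.flowOp {σ : ℤ} {A : Op X} (hA : IsBounded σ A) (j : ℕ) :
    IsBounded σ (flowOp A j) :=
  (hA.opPow (j + 1)).smul _

theorem IsLower.isBounded {A : Op X} (hA : IsLower A) : IsBounded 1 A :=
  ⟨0, fun n hn => hA.2 n (by omega)⟩

theorem IsUpper.isBounded {A : Op X} (hA : IsUpper A) : IsBounded (-1) A :=
  ⟨0, fun n hn => hA n (by omega)⟩

/-- A common one-sided bound makes the double sum finite, and Fubini applies. -/
theorem comp_assoc {σ : ℤ} (hσ : σ * σ = 1) {A B C : Op X} (hA : IsBounded σ A)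
    (hB : IsBounded σ B) (hC : IsBounded σ C) :
    comp (comp A B) C = comp A (comp B C) := by
  obtain ⟨N, hN⟩ := hA
  obtain ⟨M, hM⟩ := hB
  obtain ⟨K, hK⟩ := hC
  funext n x
  have hfin : (Function.support fun p : ℤ × ℤ => A p.1 x *
      (B (p.2 - p.1) (dil X (2 * p.1) x) * C (n - p.2) (dil X (2 * p.2) x))).Finite := by
    refine (((Finset.Icc (σ * n - K - M) N).image (σ * ·)) ×ˢ
      ((Finset.Icc (σ * n - K) (N + M)).image (σ * ·))).finite_toSet.subset ?_
    rintro ⟨i, k⟩ hi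
    have h1 : ¬ N < σ * i := fun h => left_ne_zero_of_mul hi (congrFun (hN i h) x)
    have h2 : ¬ M < σ * (k - i) := fun h =>
      left_ne_zero_of_mul (right_ne_zero_of_mul hi) (congrFun (hM _ h) _)
    have h3 : ¬ K < σ * (n - k) := fun h =>
      right_ne_zero_of_mul (right_ne_zero_of_mul hi) (congrFun (hK _ h) _)
    rw [mul_sub] at h2 h3
    exact Finset.mem_coe.2 (Finset.mem_product.2
      ⟨mem_image_Icc (i := i) hσ (by omega) (by omega),
        mem_image_Icc (i := k) hσ (by omega) (by omega)⟩)
  have hfin' : (Function.support fun p : ℤ × ℤ => A p.2 x *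
      (B (p.1 - p.2) (dil X (2 * p.2) x) * C (n - p.1) (dil X (2 * p.1) x))).Finite := by
    have := hfin.preimage (Equiv.prodComm ℤ ℤ).injective.injOn
    exact this
  have h1 := finsum_curry _ hfin
  have h2 := finsum_curry _ hfin'
  have h3 := finsum_comp_equiv (Equiv.prodComm ℤ ℤ) (f := fun p : ℤ × ℤ => A p.1 x *
      (B (p.2 - p.1) (dil X (2 * p.1) x) * C (n - p.2) (dil X (2 * p.2) x)))
  simp only [Equiv.prodComm_apply, Prod.fst_swap, Prod.snd_swap] at h3
  have h4 : comp (comp A B) C n x = ∑ᶠ k, ∑ᶠ i, A i x *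
      (B (k - i) (dil X (2 * i) x) * C (n - k) (dil X (2 * k) x)) := by
    refine finsum_congr fun k => ?_
    rw [QToda.comp, finsum_mul]
    exact finsum_congr fun i => mul_assoc _ _ _
  have h5 : comp A (comp B C) n x = ∑ᶠ i, ∑ᶠ k, A i x *
      (B (k - i) (dil X (2 * i) x) * C (n - k) (dil X (2 * k) x)) := by
    refine finsum_congr fun i => ?_
    rw [QToda.comp, mul_finsum]
    refine Eq.trans (finsum_congr fun j => ?_) (finsum_comp_equiv (Equiv.addLeft i))
    rw [Equiv.coe_addLeft, add_sub_cancel_left, dil_dil, ← mul_add, add_comm j i, sub_sub]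
  rw [h4, h5, ← h1, ← h2, h3]

theorem comp_add {σ : ℤ} (hσ : σ * σ = 1) {A B C : Op X} (hA : IsBounded σ A)
    (hB : IsBounded σ B) (hC : IsBounded σ C) : comp A (B + C) = comp A B + comp A C := by
  funext n x
  simp only [comp, Pi.add_apply, mul_add]
  exact finsum_add_distrib (comp_support_finite hσ hA hB n x) (comp_support_finite hσ hA hC n x)

theorem add_comp {σ : ℤ} (hσ : σ * σ = 1) {A B C : Op X} (hA : IsBounded σ A)
    (hB : IsBounded σ B) (hC : IsBounded σ C) : comp (A + B) C = comp A C + comp B C := by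
  funext n x
  simp only [comp, Pi.add_apply, add_mul]
  exact finsum_add_distrib (comp_support_finite hσ hA hC n x) (comp_support_finite hσ hB hC n x)

theorem smul_comp (c : ℂ) (A B : Op X) : comp (c • A) B = c • comp A B := by
  funext n x
  simp only [comp, Pi.smul_apply, smul_mul_assoc, smul_finsum]

theorem comp_smul (c : ℂ) (A B : Op X) : comp A (c • B) = c • comp A B := by
  funext n x
  simp only [comp, Pi.smul_apply, mul_smul_comm, smul_finsum]

theorem comp_sub {σ : ℤ} (hσ : σ * σ = 1) {A B C : Op X} (hA : IsBounded σ A)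
    (hB : IsBounded σ B) (hC : IsBounded σ C) : comp A (B - C) = comp A B - comp A C := by
  rw [sub_eq_add_neg, ← neg_one_smul ℂ C, comp_add hσ hA hB (hC.smul _), comp_smul,
    neg_one_smul, ← sub_eq_add_neg]

theorem sub_comp {σ : ℤ} (hσ : σ * σ = 1) {A B C : Op X} (hA : IsBounded σ A)
    (hB : IsBounded σ B) (hC : IsBounded σ C) : comp (A - B) C = comp A C - comp B C := by
  rw [sub_eq_add_neg, ← neg_one_smul ℂ B, add_comp hσ hA (hB.smul _) hC, smul_comp,
    neg_one_smul, ← sub_eq_add_neg]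

theorem comp_one (A : Op X) : comp A (shiftPow X 0) = A := by
  funext n x
  rw [comp_shiftPow, sub_zero]

theorem one_comp (A : Op X) : comp (shiftPow X 0) A = A := by
  funext n x
  rw [shiftPow_comp, sub_zero, mul_zero, dil_zero]

theorem shiftPow_comp_shiftPow (k m : ℤ) :
    comp (shiftPow X k) (shiftPow X m) = shiftPow X (k + m) := by
  funext n x
  rw [comp_shiftPow]
  simp only [shiftPow, sub_eq_iff_eq_add]

theorem timeDeriv_comp {σ : ℤ} (hσ : σ * σ = 1) {A B : Op X} (hA : IsBounded σ A)
    (hB : IsBounded σ B) (j : ℕ) :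
    timeDeriv j (comp A B) = comp (timeDeriv j A) B + comp A (timeDeriv j B) := by
  funext n x
  have h := (MvPowerSeries.pderiv (σ := ℕ) ℂ j).toLinearMap.toAddMonoidHom.map_finsum
    (comp_support_finite hσ hA hB n x)
  refine h.trans ?_
  rw [Pi.add_apply, Pi.add_apply]
  unfold comp
  rw [← finsum_add_distrib (comp_support_finite hσ (hA.timeDeriv j) hB n x)
    (comp_support_finite hσ hA (hB.timeDeriv j) n x)]
  refine finsum_congr fun i => ?_
  change MvPowerSeries.pderiv ℂ j (_ * _) = _
  rw [Derivation.leibniz, smul_eq_mul, smul_eq_mul, add_comm, mul_comm (B _ _)]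
  rfl

theorem plusPart_add_minusPart (A : Op X) : plusPart A + minusPart A = A := by
  funext n x
  rw [Pi.add_apply, Pi.add_apply, plusPart, minusPart]
  split_ifs <;> first | omega | simp

/-- An operator with nonzero leading coefficient (of order `0`) is left cancellable. -/
theorem eq_zero_of_comp_eq_zero {σ : ℤ} (hσ : σ * σ = 1) {A C : Op X}
    (hA : ∀ n, 0 < σ * n → A n = 0) (hA0 : ∀ x, A 0 x ≠ 0) (hC : IsBounded σ C)
    (h : comp A C = 0) : C = 0 := by
  obtain ⟨N, hN⟩ := hC
  -- Coefficients vanish one after another from the top: if all higher ones are zero, the next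
  -- coefficient of the product is A₀ Cₙ, and power series over ℂ have no zero divisors.
  have key : ∀ (k : ℕ) (n : ℤ), N - k < σ * n → C n = 0 := by
    intro k
    induction k with
    | zero => exact fun n hn => hN n (by omega)
    | succ k ih =>
      intro n hn
      by_cases hlt : N - k < σ * n
      · exact ih n hlt
      funext x
      have h1 : comp A C n x = A 0 x * C n x := by
        unfold comp
        rw [finsum_eq_single _ 0]
        · rw [sub_zero, mul_zero, dil_zero]
        · intro i hi
          by_cases hpos : 0 < σ * i
          · rw [hA i hpos, Pi.zero_apply, zero_mul]
          · have hne : σ * i ≠ 0 := fun h0 => hi (by linear_combination σ * h0 - i * hσ)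
            rw [ih (n - i) (by rw [mul_sub]; omega), Pi.zero_apply, mul_zero]
      rw [h, Pi.zero_apply, Pi.zero_apply] at h1
      exact (mul_eq_zero.1 h1.symm).resolve_left (hA0 x)
  funext n
  exact key (N - σ * n + 1).toNat n (by omega)

/-- Cancel A on the left in A (B A - 1) = 0. -/
theorem areInverse_of_comp_eq_one {σ : ℤ} (hσ : σ * σ = 1) {A B : Op X}
    (hA : ∀ n, 0 < σ * n → A n = 0) (hA0 : ∀ x, A 0 x ≠ 0) (hB : IsBounded σ B)
    (h : comp A B = shiftPow X 0) : AreInverse A B := by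
  have hA' : IsBounded σ A := ⟨0, hA⟩
  refine ⟨h, sub_eq_zero.1 (eq_zero_of_comp_eq_zero hσ hA hA0
    ((hB.comp hA').sub (isBounded_shiftPow σ 0)) ?_)⟩
  rw [comp_sub hσ hA' (hB.comp hA') (isBounded_shiftPow σ 0), ← comp_assoc hσ hA' hB hA', h,
    one_comp, comp_one, sub_self]

theorem opPow_comp {σ : ℤ} (hσ : σ * σ = 1) {L T : Op X} (hL : IsBounded σ L)
    (hT : IsBounded σ T) (k : ℤ) (h : comp L T = comp T (shiftPow X k)) (n : ℕ) :
    comp (opPow L n) T = comp T (shiftPow X (k * n)) := by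
  induction n with
  | zero => rw [opPow, one_comp, Nat.cast_zero, mul_zero, comp_one]
  | succ n ih =>
    rw [opPow, comp_assoc hσ (hL.opPow n) hL hT, h,
      ← comp_assoc hσ (hL.opPow n) hT (isBounded_shiftPow σ k), ih,
      comp_assoc hσ hT (isBounded_shiftPow σ _) (isBounded_shiftPow σ _), shiftPow_comp_shiftPow]
    congr 2
    push_cast
    ring

/-! ### Multiplication operators -/

/-- The operator of multiplication by a function. -/
def mulOp (g : Fn X) : Op X :=
  fun n x => if n = 0 then g x else 0

theorem mulOp_comp (g : Fn X) (A : Op X) (n : ℤ) (x : X.carrier) :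
    comp (mulOp g) A n x = g x * A n x := by
  unfold comp mulOp
  rw [finsum_eq_single _ 0]
  · rw [if_pos rfl, sub_zero, mul_zero, dil_zero]
  · intro i hi
    rw [if_neg hi, zero_mul]

theorem comp_mulOp (A : Op X) (h : Fn X) (n : ℤ) (x : X.carrier) :
    comp A (mulOp h) n x = A n x * h (dil X (2 * n) x) := by
  unfold comp mulOp
  rw [finsum_eq_single _ n]
  · rw [if_pos (sub_self n)]
  · intro i hi
    rw [if_neg (by omega), mul_zero]

theorem isBounded_mulOp (σ : ℤ) (g : Fn X) : IsBounded σ (mulOp g) := by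
  refine ⟨0, fun n hn => funext fun x => ?_⟩
  rw [mulOp, if_neg (by rintro rfl; simp at hn), Pi.zero_apply]

theorem mulOp_comp_comp (g : Fn X) (A B : Op X) (n : ℤ) (x : X.carrier) :
    comp (comp (mulOp g) A) B n x = g x * comp A B n x := by
  unfold comp
  rw [mul_finsum]
  refine finsum_congr fun i => ?_
  rw [← mul_assoc, ← mulOp_comp g A i x]
  rfl

theorem comp_comp_mulOp (A B : Op X) (h : Fn X) (n : ℤ) (x : X.carrier) :
    comp A (comp B (mulOp h)) n x = comp A B n x * h (dil X (2 * n) x) := by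
  rw [comp, comp, finsum_mul]
  refine finsum_congr fun i => ?_
  rw [comp_mulOp, dil_dil, ← mul_add, sub_add_cancel, mul_assoc]

/-! ### The derivations `dressedDeriv` -/

theorem dressedDeriv_eq (σ : ℤ) (j : ℕ) (A : Op X) :
    dressedDeriv σ j A =
      timeDeriv j A + expCoeff ε σ j • comp A (shiftPow X (σ * ((j + 1 : ℕ) : ℤ))) := by
  funext n x
  rw [Pi.add_apply, Pi.add_apply, Pi.smul_apply, Pi.smul_apply, comp_shiftPow]
  push_cast
  rfl

/-- The twist is a right multiplication, so it affects only the right factor. -/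
theorem dressedDeriv_comp {σ : ℤ} (hσ : σ * σ = 1) {A B : Op X} (hA : IsBounded σ A)
    (hB : IsBounded σ B) (j : ℕ) :
    dressedDeriv σ j (comp A B) = comp (timeDeriv j A) B + comp A (dressedDeriv σ j B) := by
  have hk := isBounded_shiftPow (X := X) σ (σ * ((j + 1 : ℕ) : ℤ))
  rw [dressedDeriv_eq, dressedDeriv_eq, timeDeriv_comp hσ hA hB,
    comp_add hσ hA (hB.timeDeriv j) ((hB.comp hk).smul _), comp_smul, comp_assoc hσ hA hB hk,
    add_assoc]

/-- The operators `P_a` with `dressedDeriv ^ a (G T) = P_a T` if `dressedDeriv T = N T`. -/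
def iterateFlow (N : ℕ → Op X) (G : Op X) : List ℕ → Op X
  | [] => G
  | j :: a => timeDeriv j (iterateFlow N G a) + comp (iterateFlow N G a) (N j)

theorem isBounded_iterateFlow {σ : ℤ} {N : ℕ → Op X} {G : Op X} (hN : ∀ j, IsBounded σ (N j))
    (hG : IsBounded σ G) (a : List ℕ) : IsBounded σ (iterateFlow N G a) := by
  induction a with
  | nil => exact hG
  | cons j a ih => exact (ih.timeDeriv j).add (ih.comp (hN j))

theorem iterate_dressedDeriv_comp {σ : ℤ} (hσ : σ * σ = 1) {N : ℕ → Op X} {G T : Op X}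
    (hN : ∀ j, IsBounded σ (N j)) (hG : IsBounded σ G) (hT : IsBounded σ T)
    (h : ∀ j, dressedDeriv σ j T = comp (N j) T) (a : List ℕ) :
    a.foldr (dressedDeriv σ) (comp G T) = comp (iterateFlow N G a) T := by
  induction a with
  | nil => rfl
  | cons j a ih =>
    have hP := isBounded_iterateFlow hN hG a
    rw [List.foldr_cons, ih, dressedDeriv_comp hσ hP hT, h, iterateFlow,
      add_comp hσ (hP.timeDeriv j) (hP.comp (hN j)) hT, comp_assoc hσ hP (hN j) hT]

/-- T intertwines Λ_q^σ with L and then cancels against its inverse. The outcome involves only `N`,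
`G`, `L`, `H`, which S and S̄ share. -/
theorem iterate_dressedDeriv_comp_comp {σ : ℤ} (hσ : σ * σ = 1) {N : ℕ → Op X}
    {G T Tinv L H : Op X} (hN : ∀ j, IsBounded σ (N j)) (hG : IsBounded σ G)
    (hT : IsBounded σ T) (hTinv : IsBounded σ Tinv) (hL : IsBounded σ L) (hH : IsBounded σ H)
    (hinv : comp T Tinv = shiftPow X 0) (hLT : comp L T = comp T (shiftPow X σ))
    (h : ∀ j, dressedDeriv σ j T = comp (N j) T) (r : ℕ) (a : List ℕ) :
    comp (comp (a.foldr (dressedDeriv σ) (comp G T)) (shiftPow X (σ * r))) (comp Tinv H) =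
      comp (iterateFlow N G a) (comp (opPow L r) H) := by
  have hP := isBounded_iterateFlow hN hG a
  have hk := isBounded_shiftPow (X := X) σ (σ * r)
  rw [iterate_dressedDeriv_comp hσ hN hG hT h, comp_assoc hσ hP hT hk,
    ← opPow_comp hσ hL hT σ hLT, comp_assoc hσ hP ((hL.opPow r).comp hT) (hTinv.comp hH),
    comp_assoc hσ (hL.opPow r) hT (hTinv.comp hH), ← comp_assoc hσ hT hTinv hH, hinv, one_comp]

end Algebra

section TauFunction

variable {ε : ℂ} {X : Domain ε}

/-! ### Symbols of the wave operators -/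

theorem op_ext_of_bounded {σ : ℤ} (hσ : σ * σ = 1) {A B : Op X}
    (hA : ∀ n, 0 < σ * n → A n = 0) (hB : ∀ n, 0 < σ * n → B n = 0)
    (h : ∀ (m : ℕ) x, A (-σ * m) x = B (-σ * m) x) : A = B := by
  funext n x
  by_cases hn : 0 < σ * n
  · rw [hA n hn, hB n hn]
  · obtain ⟨m, hm⟩ := Int.eq_ofNat_of_zero_le (not_lt.1 hn |> neg_nonneg.2)
    have : n = -σ * m := by linear_combination (-σ) * hm - n * hσ
    rw [this, h]

theorem shiftedTau_natCast (σ : ℤ) (τ : Fn X) (x : X.carrier) (m : ℕ) :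
    shiftedTau X σ τ x m =
      PowerSeries.coeff m (timeShift (-(σ : ℂ) * ε) (τ (dil X (-σ) x))) :=
  HahnSeries.ofPowerSeries_apply_coeff _ m

theorem coeff_zero_timeShift (c : ℂ) (f : TimeSeries) :
    PowerSeries.coeff 0 (timeShift c f) = f := by
  simp [timeShift, formalExp]

theorem leftOp_of_pos {σ : ℤ} (τ : Fn X) (n : ℤ) (hn : 0 < σ * n) : leftOp X σ τ n = 0 :=
  funext fun x => shiftedTau_of_neg X σ τ x (by rw [neg_mul]; omega)

theorem rightOp_of_pos {σ : ℤ} (τ : Fn X) (n : ℤ) (hn : 0 < σ * n) : rightOp X σ τ n = 0 :=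
  funext fun x => shiftedTau_of_neg X (-σ) τ _ (by rw [neg_mul]; omega)

theorem leftOp_neg_mul {σ : ℤ} (hσ : σ * σ = 1) (τ : Fn X) (m : ℕ) (x : X.carrier) :
    leftOp X σ τ (-σ * m) x =
      PowerSeries.coeff m (timeShift (-(σ : ℂ) * ε) (τ (dil X (-σ) x))) := by
  rw [← shiftedTau_natCast, leftOp]
  congr 1
  linear_combination m * hσ

theorem rightCoeff_rightOp {σ : ℤ} (hσ : σ * σ = 1) (τ : Fn X) (m : ℕ) (x : X.carrier) :
    rightCoeff (rightOp X σ τ) (-σ * m) x =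
      PowerSeries.coeff m (timeShift ((σ : ℂ) * ε) (τ (dil X σ x))) := by
  have h := shiftedTau_natCast (-σ) τ x m
  rw [Int.cast_neg, neg_neg, neg_neg] at h
  rw [← h, rightCoeff, rightOp, dil_dil, show 2 * (-σ * (m : ℤ)) + -2 * (-σ * m) = 0 by ring,
    dil_zero]
  congr 1
  linear_combination m * hσ

theorem leftOp_zero (σ : ℤ) (τ : Fn X) (x : X.carrier) :
    leftOp X σ τ 0 x = τ (dil X (-σ) x) := by
  have h := shiftedTau_natCast σ τ x 0
  rw [coeff_zero_timeShift] at h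
  rw [← h, leftOp, mul_zero, Nat.cast_zero]

theorem rightOp_zero (σ : ℤ) (τ : Fn X) (x : X.carrier) :
    rightOp X σ τ 0 x = τ (dil X σ x) := by
  have h := shiftedTau_natCast (-σ) τ x 0
  rw [coeff_zero_timeShift, neg_neg] at h
  rw [← h, rightOp, mul_zero, mul_zero, dil_zero, Nat.cast_zero]

theorem leftOp_eq_mulOp_comp {σ : ℤ} (hσ : σ * σ = 1) {τ : Fn X} {T : Op X}
    (hT : ∀ n, 0 < σ * n → T n = 0)
    (h : ∀ (m : ℕ) x, τ (dil X (-1) x) * T (-σ * m) x =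
      PowerSeries.coeff m (timeShift (-(σ : ℂ) * ε) (τ (dil X (-σ) x)))) :
    leftOp X σ τ = comp (mulOp fun x => τ (dil X (-1) x)) T := by
  refine op_ext_of_bounded hσ (leftOp_of_pos τ) (fun n hn => funext fun x => ?_) fun m x => ?_
  · rw [mulOp_comp, hT n hn, Pi.zero_apply, mul_zero]
  · rw [leftOp_neg_mul hσ, mulOp_comp, h]

theorem rightOp_eq_comp_mulOp {σ : ℤ} (hσ : σ * σ = 1) {τ : Fn X} {T : Op X}
    (hT : ∀ n, 0 < σ * n → T n = 0)
    (h : ∀ (m : ℕ) x, τ (dil X 1 x) * rightCoeff T (-σ * m) x =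
      PowerSeries.coeff m (timeShift ((σ : ℂ) * ε) (τ (dil X σ x)))) :
    rightOp X σ τ = comp T (mulOp fun x => τ (dil X 1 x)) := by
  refine op_ext_of_bounded hσ (rightOp_of_pos τ) (fun n hn => funext fun x => ?_) fun m x => ?_
  · rw [comp_mulOp, hT n hn, Pi.zero_apply, zero_mul]
  · have h1 := h m (dil X (2 * (-σ * m)) x)
    rw [← rightCoeff_rightOp hσ, rightCoeff, rightCoeff, dil_dil X (-2 * _),
      show -2 * (-σ * (m : ℤ)) + 2 * (-σ * m) = 0 by ring, dil_zero] at h1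
    rw [comp_mulOp, ← h1, mul_comm]

/-! ### From dressing operators to the bilinear identities -/

/-- The generator `((Bⱼ)₊ - (Bⱼ)₋) / (2 ε)` of the symmetric form of the Sato equations. -/
def symmetricFlow (L : Op X) (j : ℕ) : Op X :=
  (2 * ε)⁻¹ • flowOp L j - ε⁻¹ • minusPart (flowOp L j)

theorem IsBounded.symmetricFlow {σ : ℤ} {L : Op X} (hL : IsBounded σ L) (j : ℕ) :
    IsBounded σ (symmetricFlow L j) :=
  ((hL.flowOp j).smul _).sub ((hL.flowOp j).minusPart.smul _)

theorem flowOp_comp {σ : ℤ} (hσ : σ * σ = 1) {L T : Op X} (hL : IsBounded σ L)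
    (hT : IsBounded σ T) (h : comp L T = comp T (shiftPow X σ)) (j : ℕ) :
    comp (flowOp L j) T =
      (((j + 1)! : ℕ) : ℂ)⁻¹ • comp T (shiftPow X (σ * ((j + 1 : ℕ) : ℤ))) := by
  rw [← opPow_comp hσ hL hT σ h, ← smul_comp]
  rfl

theorem symmetricFlow_comp {σ : ℤ} (hσ : σ * σ = 1) {L T : Op X} (hL : IsBounded σ L)
    (hT : IsBounded σ T) (j : ℕ) :
    comp (symmetricFlow L j) T =
      (2 * ε)⁻¹ • comp (flowOp L j) T - ε⁻¹ • comp (minusPart (flowOp L j)) T := by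
  rw [symmetricFlow, sub_comp hσ ((hL.flowOp j).smul _) ((hL.flowOp j).minusPart.smul _) hT,
    smul_comp, smul_comp]

namespace IsDressingPair

variable {S Sinv Sb Sbinv : Op X}

theorem isBounded_lax (h : IsDressingPair S Sinv Sb Sbinv) : IsBounded 1 (lax S Sinv) :=
  (h.lower.isBounded.comp (isBounded_shiftPow 1 1)).comp h.lower_inv.isBounded

theorem isBounded_neg_lax (h : IsDressingPair S Sinv Sb Sbinv) :
    IsBounded (-1) (lax S Sinv) := by
  rw [h.lax_eq]
  exact (h.upper.isBounded.comp (isBounded_shiftPow _ _)).comp h.upper_inv.isBounded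

theorem lax_comp (h : IsDressingPair S Sinv Sb Sbinv) :
    comp (lax S Sinv) S = comp S (shiftPow X 1) := by
  have hS := h.lower.isBounded
  rw [lax, comp_assoc (σ := 1) rfl (hS.comp (isBounded_shiftPow 1 1)) h.lower_inv.isBounded hS,
    h.inverse.2, comp_one]

theorem lax_comp_bar (h : IsDressingPair S Sinv Sb Sbinv) :
    comp (lax S Sinv) Sb = comp Sb (shiftPow X (-1)) := by
  have hS := h.upper.isBounded
  rw [h.lax_eq, comp_assoc (σ := -1) rfl (hS.comp (isBounded_shiftPow _ _))
    h.upper_inv.isBounded hS, h.inverse_bar.2, comp_one]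

/-- The Sato equation contributes -(B_j)₋/ε and the twist B_j/(2ε), because S Λ_q^(j+1) = L^(j+1) S.
-/
theorem dressedDeriv_eq (h : IsDressingPair S Sinv Sb Sbinv) (hε : ε ≠ 0) (j : ℕ) :
    dressedDeriv 1 j S = comp (symmetricFlow (lax S Sinv) j) S := by
  have h1 : timeDeriv j S = ε⁻¹ • -comp (minusPart (flowOp (lax S Sinv) j)) S := by
    rw [← h.sato, inv_smul_smul₀ hε]
  have hk : expCoeff ε 1 j = (2 * ε)⁻¹ * (((j + 1)! : ℕ) : ℂ)⁻¹ := by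
    rw [expCoeff, Int.cast_one, one_div, mul_inv]
  rw [symmetricFlow_comp rfl h.isBounded_lax h.lower.isBounded,
    flowOp_comp rfl h.isBounded_lax h.lower.isBounded h.lax_comp, QToda.dressedDeriv_eq, h1, hk]
  module

/-- Here (B_j)₊/ε - B_j/(2ε) is the same generator as for S; the factor 1/2 in the exponents of the
vertex operators is what makes the two agree. -/
theorem dressedDeriv_bar_eq (h : IsDressingPair S Sinv Sb Sbinv) (hε : ε ≠ 0) (j : ℕ) :
    dressedDeriv (-1) j Sb = comp (symmetricFlow (lax S Sinv) j) Sb := by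
  have hB := h.isBounded_neg_lax.flowOp j
  have hP : plusPart (flowOp (lax S Sinv) j) =
      flowOp (lax S Sinv) j - minusPart (flowOp (lax S Sinv) j) :=
    eq_sub_of_add_eq (plusPart_add_minusPart _)
  have h1 : timeDeriv j Sb = ε⁻¹ • comp (plusPart (flowOp (lax S Sinv) j)) Sb := by
    rw [← h.sato_bar, inv_smul_smul₀ hε]
  have hk : expCoeff ε (-1) j = -((2 * ε)⁻¹ * (((j + 1)! : ℕ) : ℂ)⁻¹) := by
    rw [expCoeff, Int.cast_neg, Int.cast_one, neg_div, one_div, mul_inv]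
  have hε2 : ε⁻¹ = 2 * (2 * ε)⁻¹ := by
    rw [mul_inv, mul_inv_cancel_left₀ two_ne_zero]
  rw [symmetricFlow_comp rfl h.isBounded_neg_lax h.upper.isBounded, QToda.dressedDeriv_eq, h1,
    hP, sub_comp (σ := -1) rfl hB hB.minusPart h.upper.isBounded,
    flowOp_comp rfl h.isBounded_neg_lax h.upper.isBounded h.lax_comp_bar, hk, hε2]
  module

end IsDressingPair

theorem IsTauFunction.comp_eq (hε : ε ≠ 0) {τ : Fn X} (h : IsTauFunction X τ) (r : ℕ)
    (a : List ℕ) :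
    comp (comp (a.foldr (dressedDeriv 1) (leftOp X 1 τ)) (shiftPow X (1 * r)))
        (rightOp X 1 τ) =
      comp (comp (a.foldr (dressedDeriv (-1)) (leftOp X (-1) τ)) (shiftPow X (-1 * r)))
        (rightOp X (-1) τ) := by
  obtain ⟨S, Sinv, Sb, Sbinv, hd, hsymb⟩ := h
  rw [leftOp_eq_mulOp_comp (σ := 1) rfl (T := S) (fun n hn => hd.lower.2 n (by omega))
      (fun m x => by simpa using (hsymb m x).1),
    leftOp_eq_mulOp_comp (σ := -1) rfl (T := Sb) (fun n hn => hd.upper n (by omega))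
      (fun m x => by simpa using (hsymb m x).2.2.1),
    rightOp_eq_comp_mulOp (σ := 1) rfl (T := Sinv) (fun n hn => hd.lower_inv.2 n (by omega))
      (fun m x => by simpa using (hsymb m x).2.1),
    rightOp_eq_comp_mulOp (σ := -1) rfl (T := Sbinv) (fun n hn => hd.upper_inv n (by omega))
      (fun m x => by simpa using (hsymb m x).2.2.2),
    iterate_dressedDeriv_comp_comp rfl hd.isBounded_lax.symmetricFlow (isBounded_mulOp _ _)
      hd.lower.isBounded hd.lower_inv.isBounded hd.isBounded_lax (isBounded_mulOp _ _)
      hd.inverse.1 hd.lax_comp (hd.dressedDeriv_eq hε),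
    iterate_dressedDeriv_comp_comp rfl hd.isBounded_neg_lax.symmetricFlow (isBounded_mulOp _ _)
      hd.upper.isBounded hd.upper_inv.isBounded hd.isBounded_neg_lax (isBounded_mulOp _ _)
      hd.inverse_bar.1 hd.lax_comp_bar (hd.dressedDeriv_bar_eq hε)]

/-! ### From the bilinear identities to dressing operators -/

theorem dressedDeriv_mulOp_comp_comp {σ : ℤ} (hσ : σ * σ = 1) {A B : Op X}
    (hA : IsBounded σ A) (hB : IsBounded σ B) (g : Fn X) (j : ℕ) (n : ℤ) (x : X.carrier) :
    comp (dressedDeriv σ j (comp (mulOp g) A)) B n x =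
      MvPowerSeries.pderiv ℂ j (g x) * comp A B n x + g x * comp (dressedDeriv σ j A) B n x := by
  have hg := isBounded_mulOp σ g
  have hg' : timeDeriv j (mulOp g) = mulOp fun x => MvPowerSeries.pderiv ℂ j (g x) := by
    funext n x
    simp only [timeDeriv, mulOp]
    split_ifs <;> simp
  have hdA : IsBounded σ (dressedDeriv σ j A) := by
    rw [dressedDeriv_eq]
    exact (hA.timeDeriv j).add ((hA.comp (isBounded_shiftPow _ _)).smul _)
  rw [dressedDeriv_comp hσ hg hA, hg',
    add_comp hσ ((isBounded_mulOp σ _).comp hA) (hg.comp hdA) hB, Pi.add_apply, Pi.add_apply,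
    mulOp_comp_comp, mulOp_comp_comp]

/-- Dressing operators from operators which satisfy the undifferentiated bilinear identities and
the first derivatives of the one with `r = 0`. -/
theorem isDressingPair_of_comp_eq (hε : ε ≠ 0) {S Sinv Sb Sbinv : Op X} (hS : IsLower S)
    (hSinv : IsLower Sinv) (hSb : IsUpper Sb) (hSbinv : IsUpper Sbinv) (hSb0 : ∀ x, Sb 0 x ≠ 0)
    (h : ∀ r : ℕ, comp (comp S (shiftPow X (1 * r))) Sinv =
      comp (comp Sb (shiftPow X (-1 * r))) Sbinv)
    (hderiv : ∀ j, comp (dressedDeriv 1 j S) Sinv = comp (dressedDeriv (-1) j Sb) Sbinv) :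
    IsDressingPair S Sinv Sb Sbinv := by
  have h0 : comp S Sinv = comp Sb Sbinv := by
    simpa [comp_one] using h 0
  have hS1 := hS.isBounded
  have hSinv1 := hSinv.isBounded
  have hSb1 := hSb.isBounded
  have hSbinv1 := hSbinv.isBounded
  -- The left side has powers ≤ 0 and, by `h0`, also powers ≥ 0; its coefficient of order 0 is 1.
  have hone : comp S Sinv = shiftPow X 0 := by
    funext n x
    rcases lt_trichotomy n 0 with hn | rfl | hn
    · rw [h0, shiftPow, if_neg hn.ne]
      refine (finsum_congr fun i => ?_).trans finsum_zero
      by_cases hi : i < 0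
      · rw [hSb i hi, Pi.zero_apply, zero_mul]
      · rw [hSbinv _ (by omega), Pi.zero_apply, mul_zero]
    · unfold comp
      rw [finsum_eq_single _ 0, hS.1, sub_zero, hSinv.1]
      · simp [shiftPow]
      · intro i hi
        by_cases hi' : 0 < i
        · rw [hS.2 i hi', Pi.zero_apply, zero_mul]
        · rw [hSinv.2 _ (by omega), Pi.zero_apply, mul_zero]
    · rw [shiftPow, if_neg hn.ne']
      refine (finsum_congr fun i => ?_).trans finsum_zero
      by_cases hi : 0 < i
      · rw [hS.2 i hi, Pi.zero_apply, zero_mul]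
      · rw [hSinv.2 _ (by omega), Pi.zero_apply, mul_zero]
  have hinv : AreInverse S Sinv :=
    areInverse_of_comp_eq_one (σ := 1) rfl (fun n hn => hS.2 n (by omega))
      (fun x => by rw [hS.1]; exact one_ne_zero) hSinv1 hone
  have hinvb : AreInverse Sb Sbinv :=
    areInverse_of_comp_eq_one (σ := -1) rfl (fun n hn => hSb n (by omega)) hSb0 hSbinv1
      (h0 ▸ hone)
  have hL : IsBounded 1 (lax S Sinv) := (hS1.comp (isBounded_shiftPow 1 1)).comp hSinv1
  have hLS : comp (lax S Sinv) S = comp S (shiftPow X 1) := by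
    rw [lax, comp_assoc (σ := 1) rfl (hS1.comp (isBounded_shiftPow 1 1)) hSinv1 hS1, hinv.2,
      comp_one]
  have hB : ∀ j, flowOp (lax S Sinv) j = (((j + 1)! : ℕ) : ℂ)⁻¹ •
      comp (comp S (shiftPow X (1 * ((j + 1 : ℕ) : ℤ)))) Sinv := by
    intro j
    rw [← smul_comp, ← flowOp_comp (σ := 1) rfl hL hS1 hLS,
      comp_assoc (σ := 1) rfl (hL.flowOp j) hS1 hSinv1, hinv.1, comp_one]
  -- The identity with r = j + 1 turns S̄ Λ_q^(-j-1) S̄⁻¹ into S Λ_q^(j+1) S⁻¹, so the two opposite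
  -- twists B_j/(2ε) add up to B_j/ε.
  have key : ∀ j, ε • comp (timeDeriv j S) Sinv + flowOp (lax S Sinv) j =
      ε • comp (timeDeriv j Sb) Sbinv := by
    intro j
    have h1 := hderiv j
    have hk1 : expCoeff ε 1 j = (2 * ε)⁻¹ * (((j + 1)! : ℕ) : ℂ)⁻¹ := by
      rw [expCoeff, Int.cast_one, one_div, mul_inv]
    have hk2 : expCoeff ε (-1) j = -((2 * ε)⁻¹ * (((j + 1)! : ℕ) : ℂ)⁻¹) := by
      rw [expCoeff, Int.cast_neg, Int.cast_one, neg_div, one_div, mul_inv]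
    rw [dressedDeriv_eq, dressedDeriv_eq,
      add_comp (σ := 1) rfl (hS1.timeDeriv j) ((hS1.comp (isBounded_shiftPow _ _)).smul _) hSinv1,
      add_comp (σ := -1) rfl (hSb1.timeDeriv j) ((hSb1.comp (isBounded_shiftPow _ _)).smul _)
        hSbinv1, smul_comp, smul_comp, ← h (j + 1), hk1, hk2, mul_smul, ← hB, neg_smul, mul_smul,
      ← hB] at h1
    have h2 : comp (timeDeriv j Sb) Sbinv =
        comp (timeDeriv j S) Sinv + (2 * (2 * ε)⁻¹) • flowOp (lax S Sinv) j := by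
      rw [← sub_eq_add_neg] at h1
      rw [eq_add_of_sub_eq h1.symm]
      module
    rw [h2, smul_add, smul_smul, mul_inv, mul_inv_cancel_left₀ two_ne_zero,
      mul_inv_cancel₀ hε, one_smul]
  -- The leading coefficient 1 of S has zero derivative, so the product starts in order -1.
  have hneg : ∀ j n x, 0 ≤ n → comp (timeDeriv j S) Sinv n x = 0 := by
    intro j n x hn
    refine (finsum_congr fun i => ?_).trans finsum_zero
    rcases lt_trichotomy i 0 with hi | rfl | hi
    · rw [hSinv.2 _ (by omega), Pi.zero_apply, mul_zero]
    · rw [timeDeriv, hS.1, Pi.one_apply, Derivation.map_one_eq_zero, zero_mul]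
    · rw [timeDeriv, hS.2 i hi, Pi.zero_apply, map_zero, zero_mul]
  have hpos : ∀ j n x, n < 0 → comp (timeDeriv j Sb) Sbinv n x = 0 := by
    intro j n x hn
    refine (finsum_congr fun i => ?_).trans finsum_zero
    by_cases hi : i < 0
    · rw [timeDeriv, hSb i hi, Pi.zero_apply, map_zero, zero_mul]
    · rw [hSbinv _ (by omega), Pi.zero_apply, mul_zero]
  have hminus : ∀ j, ε • comp (timeDeriv j S) Sinv = -minusPart (flowOp (lax S Sinv) j) := by
    intro j
    funext n x
    have h1 := congrFun (congrFun (key j) n) x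
    simp only [Pi.add_apply, Pi.smul_apply, Pi.neg_apply, minusPart] at h1 ⊢
    split_ifs with hn
    · rw [hpos j n x hn, smul_zero] at h1
      exact eq_neg_of_add_eq_zero_left h1
    · rw [hneg j n x (by omega), smul_zero, neg_zero]
  have hplus : ∀ j, ε • comp (timeDeriv j Sb) Sbinv = plusPart (flowOp (lax S Sinv) j) := by
    intro j
    rw [← key j, hminus j, neg_add_eq_iff_eq_add, add_comm, plusPart_add_minusPart]
  refine ⟨hS, hSinv, hinv, hSb, hSbinv, hinvb, by simpa [lax] using h 1, fun j => ?_,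
    fun j => ?_⟩
  · rw [← neg_one_smul ℂ (comp _ S), ← smul_comp, neg_one_smul, ← hminus j, smul_comp,
      comp_assoc (σ := 1) rfl (hS1.timeDeriv j) hSinv1 hS1, hinv.2, comp_one]
  · rw [← hplus j, smul_comp, comp_assoc (σ := -1) rfl (hSb1.timeDeriv j) hSbinv1 hSb1,
      hinvb.2, comp_one]

theorem isTauFunction_of_comp_eq (hε : ε ≠ 0) {τ : Fn X} (hτ : IsUnit τ)
    (h : ∀ (r : ℕ) (a : List ℕ),
      comp (comp (a.foldr (dressedDeriv 1) (leftOp X 1 τ)) (shiftPow X (1 * r)))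
          (rightOp X 1 τ) =
        comp (comp (a.foldr (dressedDeriv (-1)) (leftOp X (-1) τ)) (shiftPow X (-1 * r)))
          (rightOp X (-1) τ)) :
    IsTauFunction X τ := by
  obtain ⟨τ', hττ'⟩ := hτ.exists_right_inv
  have hmul : ∀ x, τ x * τ' x = 1 := fun x => congrFun hττ' x
  have hmul' : ∀ x, τ' x * τ x = 1 := fun x => by rw [mul_comm, hmul]
  have hne : ∀ x, τ x ≠ 0 := fun x => left_ne_zero_of_mul_eq_one (hmul x)
  have hne' : ∀ x, τ' x ≠ 0 := fun x => right_ne_zero_of_mul_eq_one (hmul x)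
  let g : Fn X := fun x => τ (dil X (-1) x)
  let g' : Fn X := fun x => τ' (dil X (-1) x)
  let k : Fn X := fun x => τ (dil X 1 x)
  let k' : Fn X := fun x => τ' (dil X 1 x)
  have hg0 : ∀ x, g x ≠ 0 := fun x => hne _
  have hk0 : ∀ x, k x ≠ 0 := fun x => hne _
  have hgl : ∀ A : Op X, comp (mulOp g) (comp (mulOp g') A) = A := by
    intro A
    funext n x
    rw [mulOp_comp, mulOp_comp, ← mul_assoc, hmul, one_mul]
  have hkr : ∀ A : Op X, comp (comp A (mulOp k')) (mulOp k) = A := by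
    intro A
    funext n x
    rw [comp_mulOp, comp_mulOp, mul_assoc, hmul', mul_one]
  -- The symbol formulas force these candidates: `T 1`, `T (-1)` for S, S̄ and below `U 1`, `U (-1)`
  -- for their inverses.
  obtain ⟨T, hTdef⟩ : ∃ T : ℤ → Op X, ∀ σ, T σ = comp (mulOp g') (leftOp X σ τ) :=
    ⟨_, fun _ => rfl⟩
  obtain ⟨U, hUdef⟩ : ∃ U : ℤ → Op X, ∀ σ, U σ = comp (rightOp X σ τ) (mulOp k') :=
    ⟨_, fun _ => rfl⟩
  have hT : ∀ σ n, 0 < σ * n → T σ n = 0 := fun σ n hn => funext fun x => by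
    rw [hTdef, mulOp_comp, leftOp_of_pos τ n hn, Pi.zero_apply, mul_zero]
  have hU : ∀ σ n, 0 < σ * n → U σ n = 0 := fun σ n hn => funext fun x => by
    rw [hUdef, comp_mulOp, rightOp_of_pos τ n hn, Pi.zero_apply, zero_mul]
  have hTb : ∀ σ, IsBounded σ (T σ) := fun σ => ⟨0, hT σ⟩
  have hUb : ∀ σ, IsBounded σ (U σ) := fun σ => ⟨0, hU σ⟩
  have hT0 : ∀ σ x, T σ 0 x = g' x * τ (dil X (-σ) x) := fun σ x => by
    rw [hTdef, mulOp_comp, leftOp_zero]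
  have hU0 : ∀ σ x, U σ 0 x = τ (dil X σ x) * k' x := fun σ x => by
    rw [hUdef, comp_mulOp, rightOp_zero, mul_zero, dil_zero]
  have hTl : ∀ σ, leftOp X σ τ = comp (mulOp g) (T σ) := fun σ => by rw [hTdef, hgl]
  have hUr : ∀ σ, rightOp X σ τ = comp (U σ) (mulOp k) := fun σ => by rw [hUdef, hkr]
  have hr : ∀ r : ℕ, comp (comp (T 1) (shiftPow X (1 * r))) (U 1) =
      comp (comp (T (-1)) (shiftPow X (-1 * r))) (U (-1)) := by
    intro r
    have hassoc : ∀ (σ : ℤ), σ * σ = 1 →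
        comp (comp (mulOp g) (T σ)) (shiftPow X (σ * r)) =
          comp (mulOp g) (comp (T σ) (shiftPow X (σ * r))) := fun σ hσ =>
      comp_assoc hσ (isBounded_mulOp σ g) (hTb σ) (isBounded_shiftPow σ _)
    have h1 := h r []
    rw [List.foldr_nil, List.foldr_nil, hTl, hTl, hUr, hUr, hassoc 1 rfl, hassoc (-1) rfl] at h1
    funext n x
    have h2 := congrFun (congrFun h1 n) x
    rw [comp_comp_mulOp, comp_comp_mulOp, mulOp_comp_comp, mulOp_comp_comp] at h2
    exact mul_left_cancel₀ (hg0 _) (mul_right_cancel₀ (hk0 _) h2)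
  have hderiv : ∀ j, comp (dressedDeriv 1 j (T 1)) (U 1) =
      comp (dressedDeriv (-1) j (T (-1))) (U (-1)) := by
    intro j
    have h0 := hr 0
    rw [Nat.cast_zero, mul_zero, mul_zero, comp_one, comp_one] at h0
    have h1 := h 0 [j]
    rw [List.foldr_cons, List.foldr_cons, List.foldr_nil, List.foldr_nil, hTl, hTl, hUr, hUr,
      Nat.cast_zero, mul_zero, mul_zero, comp_one, comp_one] at h1
    funext n x
    have h2 := congrFun (congrFun h1 n) x
    rw [comp_comp_mulOp, comp_comp_mulOp] at h2
    have h3 := mul_right_cancel₀ (hk0 _) h2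
    -- The terms in which ∂ⱼ hits τ(q^(-1/2)x) agree on both sides by the case r = 0 and drop out.
    rw [dressedDeriv_mulOp_comp_comp rfl (hTb 1) (hUb 1),
      dressedDeriv_mulOp_comp_comp rfl (hTb (-1)) (hUb (-1)), h0] at h3
    exact mul_left_cancel₀ (hg0 _) (add_left_cancel h3)
  refine ⟨T 1, U 1, T (-1), U (-1), isDressingPair_of_comp_eq hε
    ⟨funext fun x => (hT0 1 x).trans (hmul' _), fun n hn => hT 1 n (by omega)⟩
    ⟨funext fun x => (hU0 1 x).trans (hmul _), fun n hn => hU 1 n (by omega)⟩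
    (fun n hn => hT (-1) n (by omega)) (fun n hn => hU (-1) n (by omega))
    (fun x => by rw [hT0]; exact mul_ne_zero (hne' _) (hne _)) hr hderiv, fun m x => ?_⟩
  have hleft : ∀ σ : ℤ, σ * σ = 1 → τ (dil X (-1) x) * T σ (-σ * m) x =
      PowerSeries.coeff m (timeShift (-(σ : ℂ) * ε) (τ (dil X (-σ) x))) := by
    intro σ hσ
    rw [← leftOp_neg_mul hσ, hTl σ, mulOp_comp]
  have hright : ∀ σ : ℤ, σ * σ = 1 → τ (dil X 1 x) * rightCoeff (U σ) (-σ * m) x =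
      PowerSeries.coeff m (timeShift ((σ : ℂ) * ε) (τ (dil X σ x))) := by
    intro σ hσ
    rw [← rightCoeff_rightOp hσ, hUr σ, rightCoeff, rightCoeff, comp_mulOp, dil_dil,
      show 2 * (-σ * (m : ℤ)) + -2 * (-σ * m) = 0 by ring, dil_zero, mul_comm]
  exact ⟨by simpa using hleft 1 rfl, by simpa using hright 1 rfl, by simpa using hleft (-1) rfl,
    by simpa using hright (-1) rfl⟩

end TauFunction

end QToda

end

theorem mainTheorem1 (ε : ℂ) (hε : ε ≠ 0) (X : QToda.Domain ε) (τ : QToda.Fn X)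
    (hτ : IsUnit τ) :
    QToda.IsTauFunction X τ ↔
      ∀ (l : ℤ) (r : ℕ) (x' : X.carrier),
        QToda.resA (MvPowerSeries.C (QToda.lamA ((r : ℤ) - 1)) * QToda.pairA X τ l x') =
          QToda.resB (MvPowerSeries.C (QToda.lamB (-(r : ℤ) - 1)) * QToda.pairB X τ l x') :=
  ⟨fun h => (QToda.forall_residue_eq_iff X τ).2 (h.comp_eq hε),
    fun h => QToda.isTauFunction_of_comp_eq hε hτ ((QToda.forall_residue_eq_iff X τ).1 h)⟩
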